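/- Let $K$ be a (possibly disconnected) compact Lie group with identity component $K^o$, let $s \ge 2$, and let $\Gamma$ be a finitely generated $s$-step nilpotent group: with $\Gamma_{(1)} = \Gamma$ and $\Gamma_{(i+1)} = [\Gamma, \Gamma_{(i)}]$, the group $\Gamma_{(s)}$ is non-trivial and $\Gamma_{(s+1)}$ is trivial. Give $\mathrm{Hom}(\Gamma, K)$ the topology of pointwise convergence (equivalently, the subspace topology of the finite product of copies of $K$ indexed by a finite generating set of $\Gamma$), and let $$\mathcal{F} := \{\rho(\Gamma_{(s)}) \subset K : \rho \in \mathrm{Hom}(\Gamma, K)\}, \qquad p : \mathrm{Hom}(\Gamma, K) \to \mathcal{F},\quad p(\rho) = \rho(\Gamma_{(s)}).$$ Then every element of $\mathcal{F}$ is an abelian subgroup of $K$, and $\mathcal{F}$ admits a homogeneous manifold structure with finitely many connected components for which $p$ is a locally trivial fibre bundle. Here a homogeneous manifold structure on $\mathcal{F}$ is a Hausdorff second countable topology whose connected components are open and are exactly the orbits of the conjugation action of $K^o$ on $\mathcal{F}$, together with a smooth manifold structure on each component (the dimension may depend on the component) for which the transitive action of $K^o$ is smooth. That $p$ is a locally trivial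 fibre bundle means that each $A \in \mathcal{F}$ has an open neighbourhood $U$ with a homeomorphism $p^{-1}(U) \cong U \times p^{-1}(A)$ over $U$ (the fibre may vary with the component of $\mathcal{F}$). -/

import Mathlib

open scoped Manifold ContDiff

namespace NilpotentRep

/-- The lower central series indexed from one: `lcs Γ 1 = Γ`, `lcs Γ (i + 1) = [lcs Γ i, Γ]`. -/
def lcs (Γ : Type*) [Group Γ] (i : ℕ) : Subgroup Γ :=
  (⊤ : Subgroup Γ).lowerCentralSeries (i - 1)

/-- `Γ` is nilpotent of step exactly `s`. -/
def IsStepNilpotent (Γ : Type*) [Group Γ] (s : ℕ) : Prop :=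
  lcs Γ s ≠ ⊥ ∧ lcs Γ (s + 1) = ⊥

/-- The topology of `Hom(Γ, K)`: pointwise convergence. For finitely generated `Γ` this is the
subspace topology of the finite product of copies of `K` indexed by a generating set. -/
instance homTopology (Γ K : Type*) [Group Γ] [Group K] [TopologicalSpace K] :
    TopologicalSpace (Γ →* K) :=
  TopologicalSpace.induced (fun ρ => (ρ : Γ → K)) inferInstance

section Family

variable (Γ K : Type*) [Group Γ] [Group K] (s : ℕ)

/-- The set of all subgroups `ρ(Γ_(s))` of `K`, for `ρ` in `Hom(Γ, K)`. -/
def family : Set (Subgroup K) :=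
  Set.range fun ρ : Γ →* K => (lcs Γ s).map ρ

/-- The projection `ρ ↦ ρ(Γ_(s))`. -/
def proj (ρ : Γ →* K) : family Γ K s :=
  ⟨(lcs Γ s).map ρ, ρ, rfl⟩

variable {Γ K s}

theorem map_conj_mem_family (k : K) {A : Subgroup K} (hA : A ∈ family Γ K s) :
    A.map (MulAut.conj k).toMonoidHom ∈ family Γ K s := by
  obtain ⟨ρ, rfl⟩ := hA
  exact ⟨(MulAut.conj k).toMonoidHom.comp ρ, (Subgroup.map_map _ _ _).symm⟩

/-- `K` acts on the family by conjugation, `k • A = k A k⁻¹`. -/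
instance conjAction : MulAction K (family Γ K s) where
  smul k A := ⟨A.1.map (MulAut.conj k).toMonoidHom, map_conj_mem_family k A.2⟩
  one_smul A := by
    apply Subtype.ext
    change A.1.map (MulAut.conj (1 : K)).toMonoidHom = A.1
    rw [map_one]
    exact Subgroup.map_id _
  mul_smul g h A := by
    apply Subtype.ext
    change A.1.map (MulAut.conj (g * h)).toMonoidHom =
      (A.1.map (MulAut.conj h).toMonoidHom).map (MulAut.conj g).toMonoidHom
    rw [map_mul, Subgroup.map_map]
    rfl

end Family

section IdentityComponent

variable (E : Type*) [NormedAddCommGroup E] [NormedSpace ℝ E]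
  (K : Type*) [Group K] [TopologicalSpace K] [ChartedSpace E K] [LieGroup 𝓘(ℝ, E) ∞ K]

/-- The identity component `K°` of the Lie group `K`. -/
def identityComponent : Subgroup K :=
  haveI : IsTopologicalGroup K := topologicalGroup_of_lieGroup 𝓘(ℝ, E) ∞
  Subgroup.connectedComponentOfOne K

theorem isOpen_identityComponent : IsOpen (identityComponent E K : Set K) := by
  have : LocallyConnectedSpace K := ChartedSpace.locallyConnectedSpace E K
  exact isOpen_connectedComponent

/-- `K°` carries the smooth structure of an open subset of `K`. -/
noncomputable instance identityComponentCharts : ChartedSpace E (identityComponent E K) :=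
  inferInstanceAs (ChartedSpace E
    (⟨identityComponent E K, isOpen_identityComponent E K⟩ : TopologicalSpace.Opens K))

theorem contMDiff_identityComponent_val :
    ContMDiff 𝓘(ℝ, E) 𝓘(ℝ, E) ∞ (fun x : identityComponent E K => (x : K)) :=
  contMDiff_subtype_val
    (U := (⟨identityComponent E K, isOpen_identityComponent E K⟩ : TopologicalSpace.Opens K))

variable {E K} in
theorem contMDiff_identityComponent_of_val {F H M : Type*} [NormedAddCommGroup F]
    [NormedSpace ℝ F] [TopologicalSpace H] [TopologicalSpace M] [ChartedSpace H M]
    {I : ModelWithCorners ℝ F H} {f : M → identityComponent E K}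
    (hf : ContMDiff I 𝓘(ℝ, E) ∞ (fun x => (f x : K))) : ContMDiff I 𝓘(ℝ, E) ∞ f := by
  intro x
  have h := contMDiffAt_iff.1 (hf x)
  exact contMDiffAt_iff.2 ⟨Topology.IsInducing.subtypeVal.continuousAt_iff.2 h.1, h.2⟩

/-- `K°` is a Lie group. -/
instance identityComponentLieGroup : LieGroup 𝓘(ℝ, E) ∞ (identityComponent E K) where
  toIsManifold :=
    haveI : IsManifold 𝓘(ℝ, E) ∞ K :=
      (inferInstance : ContMDiffMul 𝓘(ℝ, E) ∞ K).toIsManifold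
    (inferInstance : IsManifold 𝓘(ℝ, E) ∞
      (⟨identityComponent E K, isOpen_identityComponent E K⟩ : TopologicalSpace.Opens K))
  contMDiff_mul := contMDiff_identityComponent_of_val
    (((contMDiff_identityComponent_val E K).comp contMDiff_fst).mul
      ((contMDiff_identityComponent_val E K).comp contMDiff_snd))
  contMDiff_inv := contMDiff_identityComponent_of_val
    (contMDiff_identityComponent_val E K).inv

end IdentityComponent

/-- A homogeneous manifold structure on a set `X` with an action of a Lie group `G`: a Hausdorff
second countable topology on `X` whose connected components are the `G`-orbits and are open, together
with a smooth structure on each of them (the dimension may depend on the component), such that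
`G` acts smoothly on every component. The action on an orbit is transitive, so that every
component is a homogeneous `G`-manifold. -/
structure HomogeneousManifoldStructure {E : Type*} [NormedAddCommGroup E] [NormedSpace ℝ E]
    (G : Type*) [Group G] [TopologicalSpace G] [ChartedSpace E G] [LieGroup 𝓘(ℝ, E) ∞ G]
    (X : Type*) [MulAction G X] where
  /-- the topology -/
  top : TopologicalSpace X
  t2 : T2Space X
  secondCountable : SecondCountableTopology X
  component_eq_orbit : ∀ x : X, connectedComponent x = MulAction.orbit G x
  isOpen_orbit : ∀ x : X, IsOpen (MulAction.orbit G x)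
  /-- the dimension of a component -/
  dim : MulAction.orbitRel.Quotient G X → ℕ
  /-- the charts of a component -/
  charts : ∀ C : MulAction.orbitRel.Quotient G X,
    ChartedSpace (EuclideanSpace ℝ (Fin (dim C))) C.orbit
  isManifold : ∀ C : MulAction.orbitRel.Quotient G X, IsManifold (𝓡 (dim C)) ∞ C.orbit
  smooth_action : ∀ C : MulAction.orbitRel.Quotient G X,
    ContMDiffSMul 𝓘(ℝ, E) (𝓡 (dim C)) ∞ G C.orbit

/-- A map is a locally trivial fibre bundle if every point `b` of the base has an open
neighbourhood over which the map is isomorphic to a product projection. The fibre of such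
a product is homeomorphic to the fibre over `b`; it may vary with the component of the base. -/
def IsLocallyTrivialFibreBundle {Z B : Type*} [TopologicalSpace Z] [TopologicalSpace B]
    (f : Z → B) : Prop :=
  ∀ b : B, ∃ e : Bundle.Trivialization (f ⁻¹' {b}) f, b ∈ e.baseSet

end NilpotentRep

/-! The subgroup p(ρ) depends only on the restriction of ρ to Γ_(s), and all these restrictions
factor through one finite group. Indeed, for s ≥ 2 the group Γ_(s) is central and generated by
commutators. If c = [x, y] in K commutes with x and y, then [x^i, y^j] = c^(ij). By compactness some
x^i, with 1 ≤ i ≤ N and N independent of x, is so close to 1 that all its commutators lie in a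
neighbourhood of 1 without nontrivial subgroups; hence c^i = 1 (`exists_uniform_exponent`,
`exists_nhds_no_small_subgroups`). So N! kills every ρ(Γ_(s)). As Γ_(s) is finitely generated
abelian, its quotient A by the common kernel is finite (`finite_quotient_commonKernel`).

Homomorphisms from a finite group to a Lie group are locally rigid: an averaging argument and the
implicit function theorem give a conjugator near 1 that depends smoothly on the homomorphism
(`exists_smooth_conjugator`). Hence the K°-orbit of p(ρ) is locally constant on the compact space
Hom(Γ, K), and there are finitely many orbits.

Applied to the conjugates of φ : A → K, the conjugator becomes a smooth map, idempotent near 1 in K,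
with the fibres of x ↦ xφx⁻¹. Such a map is locally a linear projection
(`exists_submersion_of_idempotent`), which gives a submersion with a smooth section, called a slice.
Near 1, an element normalising the finite group φ(A) centralises it, so the slice also serves the
action of K° on subgroups (`exists_localSlice_family`). Its translates are charts of the orbits, and
its local sections σ trivialise p by ρ ↦ (p(ρ), σ⁻¹ρσ) with σ taken at p(ρ). -/

namespace NilpotentRep
open Filter Topology
open scoped commutatorElement

/-! ### Lower central series of a finitely generated group. -/

section GroupTheory

variable {Γ : Type*} [Group Γ]

theorem lcs_succ {s : ℕ} (hs : 1 ≤ s) : lcs Γ (s + 1) = ⁅lcs Γ s, (⊤ : Subgroup Γ)⁆ := by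
  obtain ⟨n, rfl⟩ : ∃ n, s = n + 1 := ⟨s - 1, by omega⟩
  rfl

theorem lcs_le_center {s : ℕ} (hs : 1 ≤ s) (h : lcs Γ (s + 1) = ⊥) :
    lcs Γ s ≤ Subgroup.center Γ := by
  rw [lcs_succ hs, Subgroup.commutator_top_right_eq_bot_iff_le_center] at h
  exact h

instance lcs_normal (s : ℕ) : (lcs Γ s).Normal := by
  unfold lcs
  infer_instance

theorem normal_of_commutator_le {H L : Subgroup Γ} (h₁ : H ≤ L) (h₂ : ⁅L, (⊤ : Subgroup Γ)⁆ ≤ H) :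
    H.Normal := by
  refine ⟨fun n hn g => ?_⟩
  have h : ⁅n, g⁆ ∈ H := h₂ (Subgroup.commutator_mem_commutator (h₁ hn) trivial)
  have h' : g * n * g⁻¹ = ⁅n, g⁆⁻¹ * n := by
    simp [commutatorElement_def, mul_assoc]
  rw [h']
  exact H.mul_mem (H.inv_mem h) hn

/-- Each term of the lower central series of a finitely generated group is finitely generated modulo
the next one. -/
theorem exists_finite_lcs_le_closure_sup [Group.FG Γ] (i : ℕ) :
    ∃ T : Set Γ, T.Finite ∧ T ⊆ lcs Γ (i + 1) ∧
      lcs Γ (i + 1) ≤ Subgroup.closure T ⊔ lcs Γ (i + 2) := by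
  obtain ⟨S, hS, hSf⟩ := (Subgroup.fg_iff _).1 (Group.fg_def.1 ‹Group.FG Γ›)
  induction i with
  | zero => exact ⟨S, hSf, fun _ _ => Subgroup.mem_top _, by rw [hS]; simp⟩
  | succ i ih =>
    obtain ⟨T, hTf, hTL, hT⟩ := ih
    set T' : Set Γ := Set.image2 (fun t x => ⁅t, x⁆) T S
    have hT' : T' ⊆ lcs Γ (i + 2) := by
      rintro _ ⟨t, ht, x, -, rfl⟩
      rw [lcs_succ (by omega)]
      exact Subgroup.commutator_mem_commutator (hTL ht) trivial
    refine ⟨T', hTf.image2 _ hSf, hT', ?_⟩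
    set H := Subgroup.closure T' ⊔ lcs Γ (i + 1 + 2)
    have e : lcs Γ (i + 1 + 2) = ⁅lcs Γ (i + 2), (⊤ : Subgroup Γ)⁆ := lcs_succ (by omega)
    have hle : lcs Γ (i + 1 + 2) ≤ lcs Γ (i + 2) := by
      rw [e]
      exact Subgroup.commutator_le_left _ _
    have hN : H.Normal := normal_of_commutator_le (L := lcs Γ (i + 2))
      (sup_le ((Subgroup.closure_le _).2 hT') hle) (e ▸ le_sup_right)
    have mem_iff : ∀ p q : Γ, ⁅p, q⁆ ∈ H ↔
        Commute (QuotientGroup.mk' H p) (QuotientGroup.mk' H q) := by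
      intro p q
      rw [← commutatorElement_eq_one_iff_commute, ← map_commutatorElement]
      exact (QuotientGroup.eq_one_iff _).symm
    let Z : Subgroup Γ := (Subgroup.center (Γ ⧸ H)).comap (QuotientGroup.mk' H)
    have memZ : ∀ p, p ∈ Z ↔ ∀ q, ⁅p, q⁆ ∈ H := by
      intro p
      simp only [mem_iff]
      rw [Subgroup.mem_comap, Subgroup.mem_center_iff]
      constructor
      · intro h q
        exact (h _).symm
      · intro h g
        obtain ⟨q, rfl⟩ := QuotientGroup.mk'_surjective H g
        exact (h q).symm
    -- Modulo H, the element t commutes with the generators S of Γ, hence with all of Γ.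
    have hTZ : T ⊆ Z := by
      intro t ht
      refine (memZ t).2 fun q => ?_
      have : Subgroup.closure S ≤
          (Subgroup.centralizer {QuotientGroup.mk' H t}).comap (QuotientGroup.mk' H) := by
        refine (Subgroup.closure_le _).2 fun x hx => ?_
        have : ⁅t, x⁆ ∈ H :=
          (le_sup_left : _ ≤ H) (Subgroup.subset_closure (Set.mem_image2_of_mem ht hx))
        rw [SetLike.mem_coe, Subgroup.mem_comap, Subgroup.mem_centralizer_singleton_iff]
        exact ((mem_iff t x).1 this).symm
      rw [hS] at this
      have := this (Subgroup.mem_top q)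
      rw [Subgroup.mem_comap, Subgroup.mem_centralizer_singleton_iff] at this
      exact (mem_iff t q).2 this.symm
    have hLZ : lcs Γ (i + 2) ≤ Z := fun p hp => (memZ p).2 fun q =>
      (le_sup_right : _ ≤ H) (e ▸ Subgroup.commutator_mem_commutator hp trivial)
    have hZ : lcs Γ (i + 1) ≤ Z := hT.trans (sup_le ((Subgroup.closure_le _).2 hTZ) hLZ)
    rw [lcs_succ (by omega), Subgroup.commutator_le]
    exact fun p hp q _ => (memZ p).1 (hZ hp) q

/-- Generation modulo the next term is plain generation at the last nontrivial term. -/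
theorem lcs_fg [Group.FG Γ] {s : ℕ} (hs : 1 ≤ s) (h : lcs Γ (s + 1) = ⊥) : (lcs Γ s).FG := by
  obtain ⟨i, rfl⟩ : ∃ i, s = i + 1 := ⟨s - 1, by omega⟩
  obtain ⟨T, hTf, hTL, hT⟩ := exists_finite_lcs_le_closure_sup (Γ := Γ) i
  rw [h, sup_bot_eq] at hT
  exact (Subgroup.fg_iff _).2 ⟨T, le_antisymm ((Subgroup.closure_le _).2 hTL) hT, hTf⟩

end GroupTheory

/-! ### Bounded order of central commutators in a compact group. -/

section Exponent

variable {K : Type*} [Group K]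

/-- Pigeonhole: finitely many translates of a small V cover K, so two of the first powers of x share
a translate, and their quotient is a power of x in V⁻¹V ⊆ W. -/
theorem exists_pow_mem_of_compact [TopologicalSpace K] [IsTopologicalGroup K] [CompactSpace K]
    {W : Set K} (hW : W ∈ 𝓝 (1 : K)) :
    ∃ N : ℕ, ∀ x : K, ∃ i, 1 ≤ i ∧ i ≤ N ∧ x ^ i ∈ W := by
  have hdiv : ContinuousAt (fun p : K × K => p.1⁻¹ * p.2) (1, 1) := by fun_prop
  have hW' : W ∈ 𝓝 ((fun p : K × K => p.1⁻¹ * p.2) (1, 1)) := by simpa using hW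
  obtain ⟨V, hV, hVW⟩ : ∃ V ∈ 𝓝 (1 : K), ∀ a ∈ V, ∀ b ∈ V, a⁻¹ * b ∈ W := by
    obtain ⟨u, v, hu, h1u, hv, h1v, h⟩ := mem_nhds_prod_iff'.1 (hdiv hW')
    refine ⟨u ∩ v, (hu.inter hv).mem_nhds ⟨h1u, h1v⟩, fun a ha b hb => ?_⟩
    exact h (Set.mk_mem_prod ha.1 hb.2)
  obtain ⟨t, -, ht⟩ := isCompact_univ.elim_nhds_subcover (fun g : K => (fun x => g⁻¹ * x) ⁻¹' V)
    (fun g _ => (continuous_const_mul g⁻¹).continuousAt.preimage_mem_nhds (by simpa using hV))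
  refine ⟨t.card, fun x => ?_⟩
  have hc : ∀ n : ℕ, ∃ g ∈ t, g⁻¹ * x ^ n ∈ V := fun n => by
    simpa using ht (Set.mem_univ (x ^ n))
  choose g hgt hgV using hc
  obtain ⟨a, ha, b, hb, hab, hgab⟩ := Finset.exists_ne_map_eq_of_card_lt_of_maps_to
    (s := Finset.range (t.card + 1)) (t := t) (by simp) (f := g) (fun n _ => hgt n)
  wlog hlt : a < b generalizing a b
  · exact this b hb a ha hab.symm hgab.symm (by omega)
  refine ⟨b - a, by omega, by simp at hb; omega, ?_⟩
  have := hVW _ (hgV a) _ (hgab ▸ hgV b)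
  rwa [mul_inv_rev, inv_inv, mul_assoc, mul_inv_cancel_left, ← zpow_natCast, ← zpow_natCast,
    ← zpow_neg, ← zpow_add, show -(a : ℤ) + b = ((b - a : ℕ) : ℤ) by omega, zpow_natCast] at this

/-- When [x, y] = c commutes with both entries, the commutator is bimultiplicative on powers of x
and y. -/
theorem conj_pow_pow_of_central {x y c : K} (hx : Commute c x) (hy : Commute c y)
    (h : x * y = c * y * x) (i j : ℕ) : x ^ i * y ^ j * (x ^ i)⁻¹ * (y ^ j)⁻¹ = (c ^ i) ^ j := by
  have h1 : ∀ i : ℕ, x ^ i * y * (x ^ i)⁻¹ = c ^ i * y := by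
    intro i
    induction i with
    | zero => simp
    | succ i ih =>
      calc x ^ (i + 1) * y * (x ^ (i + 1))⁻¹ = x * (x ^ i * y * (x ^ i)⁻¹) * x⁻¹ := by
            rw [pow_succ']; group
        _ = c ^ i * (x * y * x⁻¹) := by
            rw [ih, ← mul_assoc, ← (hx.pow_left i).eq]; group
        _ = c ^ (i + 1) * y := by rw [h, pow_succ]; group
  have h2 : x ^ i * y ^ j * (x ^ i)⁻¹ = (x ^ i * y * (x ^ i)⁻¹) ^ j := by
    rw [conj_pow]
  rw [h2, h1, (hy.pow_left i).mul_pow, mul_inv_cancel_right]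

/-- In a compact group without small subgroups, the central commutators of pairs of elements have
bounded order. -/
theorem exists_uniform_exponent [TopologicalSpace K] [IsTopologicalGroup K] [CompactSpace K]
    {V : Set K} (hV : V ∈ 𝓝 (1 : K))
    (hns : ∀ x : K, (∀ n : ℕ, x ^ n ∈ V) → x = 1) :
    ∃ m : ℕ, 0 < m ∧ ∀ x y c : K, Commute c x → Commute c y → x * y = c * y * x → c ^ m = 1 := by
  -- Compactness makes the smallness of [x, k] uniform in k.
  have hW : ∀ᶠ x in 𝓝 (1 : K), ∀ k ∈ (Set.univ : Set K), x * k * x⁻¹ * k⁻¹ ∈ V := by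
    refine isCompact_univ.eventually_forall_of_forall_eventually fun k _ => ?_
    have : ContinuousAt (fun p : K × K => p.1 * p.2 * p.1⁻¹ * p.2⁻¹) (1, k) := by fun_prop
    exact this (by simpa using hV)
  obtain ⟨N, hN⟩ := exists_pow_mem_of_compact hW
  -- The exponent i ≤ N found for x varies with x; N! is a common multiple.
  refine ⟨N.factorial, N.factorial_pos, fun x y c hx hy h => ?_⟩
  obtain ⟨i, hi, hiN, hxi⟩ := hN x
  have hci : c ^ i = 1 := hns _ fun j => by
    rw [← conj_pow_pow_of_central hx hy h i j]
    exact hxi _ trivial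
  obtain ⟨d, hd⟩ := Nat.dvd_factorial hi hiN
  rw [hd, pow_mul, hci, one_pow]

end Exponent

/-! ### Absence of small subgroups in a Lie group. -/

section NoSmallSubgroups

variable {E : Type*} [NormedAddCommGroup E] [NormedSpace ℝ E]
  {K : Type*} [Group K] [TopologicalSpace K] [ChartedSpace E K] [LieGroup 𝓘(ℝ, E) ∞ K]

theorem contMDiffOn_extChartAt_one :
    ContMDiffOn 𝓘(ℝ, E) 𝓘(ℝ, E) ∞ (extChartAt 𝓘(ℝ, E) (1 : K))
      (extChartAt 𝓘(ℝ, E) (1 : K)).source := by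
  have : IsManifold 𝓘(ℝ, E) ∞ K := (inferInstance : ContMDiffMul 𝓘(ℝ, E) ∞ K).toIsManifold
  exact (contMDiffOn_extChartAt (I := 𝓘(ℝ, E)) (n := ∞) (x := (1 : K))).mono
    (extChartAt_source _ _).subset

/-- A map into a Lie group that is smooth on an open set is smooth in the chart at `1`. -/
theorem contDiffOn_extChartAt_one_comp {F : Type*} [NormedAddCommGroup F] [NormedSpace ℝ F]
    {f : F → K} {O : Set F} (hf : ContMDiffOn 𝓘(ℝ, F) 𝓘(ℝ, E) ∞ f O)
    (h : Set.MapsTo f O (extChartAt 𝓘(ℝ, E) (1 : K)).source) :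
    ContDiffOn ℝ ∞ (fun v => extChartAt 𝓘(ℝ, E) (1 : K) (f v)) O := by
  exact (contMDiffOn_extChartAt_one.comp hf h).contDiffOn

theorem contMDiffOn_extChartAt_one_symm :
    ContMDiffOn 𝓘(ℝ, E) 𝓘(ℝ, E) ∞ (extChartAt 𝓘(ℝ, E) (1 : K)).symm
      (extChartAt 𝓘(ℝ, E) (1 : K)).target := by
  have : IsManifold 𝓘(ℝ, E) ∞ K := (inferInstance : ContMDiffMul 𝓘(ℝ, E) ∞ K).toIsManifold
  exact contMDiffOn_extChartAt_symm _

variable (E K) in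
-- The derivative of multiplication at (1, 1) is addition, as restricting one factor to 1 shows; on
-- the diagonal this is multiplication by 2.
theorem hasStrictFDerivAt_square_in_chart [CompleteSpace E] :
    HasStrictFDerivAt (fun v : E => extChartAt 𝓘(ℝ, E) (1 : K)
      ((extChartAt 𝓘(ℝ, E) (1 : K)).symm v * (extChartAt 𝓘(ℝ, E) (1 : K)).symm v))
      ((2 : ℝ) • ContinuousLinearMap.id ℝ E) (extChartAt 𝓘(ℝ, E) (1 : K) 1) := by
  have : IsTopologicalGroup K := topologicalGroup_of_lieGroup 𝓘(ℝ, E) ∞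
  set ψ := extChartAt 𝓘(ℝ, E) (1 : K)
  set e := ψ 1
  have hs1 : ψ.symm e = 1 := extChartAt_to_inv (I := 𝓘(ℝ, E)) (1 : K)
  have htgt : ψ.target ∈ 𝓝 e := extChartAt_target_mem_nhds (I := 𝓘(ℝ, E)) (1 : K)
  have hto : IsOpen ψ.target := isOpen_extChartAt_target (I := 𝓘(ℝ, E)) (1 : K)
  have hso : IsOpen ψ.source := isOpen_extChartAt_source (I := 𝓘(ℝ, E)) (1 : K)
  let g : E × E → K := fun p => ψ.symm p.1 * ψ.symm p.2
  have hg : ContMDiffOn 𝓘(ℝ, E × E) 𝓘(ℝ, E) ∞ g (ψ.target ×ˢ ψ.target) :=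
    (contMDiffOn_extChartAt_one_symm.comp contDiff_fst.contMDiff.contMDiffOn fun p hp => hp.1).mul
      (contMDiffOn_extChartAt_one_symm.comp contDiff_snd.contMDiff.contMDiffOn fun p hp => hp.2)
  have hO : IsOpen ((ψ.target ×ˢ ψ.target) ∩ g ⁻¹' ψ.source) :=
    hg.continuousOn.isOpen_inter_preimage (hto.prod hto) hso
  have hm : ContDiffOn ℝ ∞ (fun p => ψ (g p)) ((ψ.target ×ˢ ψ.target) ∩ g ⁻¹' ψ.source) :=
    contDiffOn_extChartAt_one_comp (hg.mono Set.inter_subset_left) fun p hp => hp.2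
  have hee : ((e, e) : E × E) ∈ (ψ.target ×ˢ ψ.target) ∩ g ⁻¹' ψ.source := by
    refine ⟨⟨mem_of_mem_nhds htgt, mem_of_mem_nhds htgt⟩, ?_⟩
    change ψ.symm e * ψ.symm e ∈ ψ.source
    rw [hs1, mul_one]
    exact mem_extChartAt_source (I := 𝓘(ℝ, E)) (1 : K)
  have hd : HasStrictFDerivAt (fun p => ψ (g p)) (fderiv ℝ (fun p => ψ (g p)) (e, e)) (e, e) :=
    (hm.contDiffAt (hO.mem_nhds hee)).hasStrictFDerivAt (by simp)
  set M := fderiv ℝ (fun p => ψ (g p)) (e, e)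
  have hinv : ∀ᶠ v in 𝓝 e, ψ (ψ.symm v) = v := by
    filter_upwards [htgt] with v hv using ψ.right_inv hv
  have hleft : M.comp ((ContinuousLinearMap.id ℝ E).prod (0 : E →L[ℝ] E)) =
      ContinuousLinearMap.id ℝ E := by
    have h1 : HasFDerivAt (fun v : E => (v, e)) ((ContinuousLinearMap.id ℝ E).prod 0) e :=
      (hasFDerivAt_id e).prodMk (hasFDerivAt_const e e)
    refine (HasFDerivAt.comp (g := fun p => ψ (g p)) (f := fun v : E => (v, e)) e
      hd.hasFDerivAt h1).unique
      ((hasFDerivAt_id e).congr_of_eventuallyEq ?_)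
    filter_upwards [hinv] with v hv
    simp [g, hs1, hv]
  have hright : M.comp ((0 : E →L[ℝ] E).prod (ContinuousLinearMap.id ℝ E)) =
      ContinuousLinearMap.id ℝ E := by
    have h1 : HasFDerivAt (fun v : E => (e, v)) ((0 : E →L[ℝ] E).prod (.id ℝ E)) e :=
      (hasFDerivAt_const e e).prodMk (hasFDerivAt_id e)
    refine (HasFDerivAt.comp (g := fun p => ψ (g p)) e hd.hasFDerivAt h1).unique
      ((hasFDerivAt_id e).congr_of_eventuallyEq ?_)
    filter_upwards [hinv] with v hv
    simp [g, hs1, hv]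
  have hdiag : HasStrictFDerivAt (fun v : E => (v, v))
      ((ContinuousLinearMap.id ℝ E).prod (.id ℝ E)) e :=
    (hasStrictFDerivAt_id e).prodMk (hasStrictFDerivAt_id e)
  have := HasStrictFDerivAt.comp (g := fun p => ψ (g p)) (f := fun v : E => (v, v)) e hd hdiag
  convert this using 1
  ext v
  have h1 := DFunLike.congr_fun hleft v
  have h2 := DFunLike.congr_fun hright v
  simp only [ContinuousLinearMap.comp_apply, ContinuousLinearMap.prod_apply,
    ContinuousLinearMap.id_apply, zero_apply] at h1 h2 ⊢
  rw [show ((v, v) : E × E) = (v, 0) + (0, v) by simp, map_add, h1, h2]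
  simp [two_smul]

variable (E K) in
/-- A Lie group has no small subgroups. -/
theorem exists_nhds_no_small_subgroups [CompleteSpace E] :
    ∃ V ∈ 𝓝 (1 : K), ∀ x : K, (∀ n : ℕ, x ^ n ∈ V) → x = 1 := by
  have hd := hasStrictFDerivAt_square_in_chart E K
  set ψ := extChartAt 𝓘(ℝ, E) (1 : K)
  set e := ψ 1
  have hs1 : ψ.symm e = 1 := extChartAt_to_inv (I := 𝓘(ℝ, E)) (1 : K)
  -- The derivative 2, with an error of at most 1/2, makes squaring expand distances from 1 by a
  -- factor of at least 3/2. Repeated squaring then drives any x ≠ 1 out of the unit ball of the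
  -- chart.
  have hev : ∀ᶠ v in 𝓝 e, 3 / 2 * ‖v - e‖ ≤ ‖ψ (ψ.symm v * ψ.symm v) - e‖ := by
    filter_upwards [hd.hasFDerivAt.isLittleO.def (c := 1 / 2) (by norm_num)] with v hv
    simp only [hs1, mul_one, smul_apply, ContinuousLinearMap.id_apply] at hv
    have h1 : ‖(2 : ℝ) • (v - e)‖ = 2 * ‖v - e‖ := by
      rw [norm_smul]; norm_num
    have h2 := norm_sub_norm_le ((2 : ℝ) • (v - e)) (ψ (ψ.symm v * ψ.symm v) - e)
    rw [norm_sub_rev ((2 : ℝ) • (v - e))] at h2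
    have h3 : ψ 1 = e := rfl
    rw [h3] at hv
    linarith
  have hc : Tendsto ψ (𝓝 (1 : K)) (𝓝 e) := continuousAt_extChartAt (I := 𝓘(ℝ, E)) (1 : K)
  have hball : ∀ᶠ v in 𝓝 e, ‖v - e‖ < 1 := by
    have : Tendsto (fun v => ‖v - e‖) (𝓝 e) (𝓝 0) := by
      have : Continuous fun v => ‖v - e‖ := by fun_prop
      simpa using this.tendsto e
    exact this.eventually_lt_const one_pos
  refine ⟨_, inter_mem (extChartAt_source_mem_nhds (I := 𝓘(ℝ, E)) (1 : K))
    (hc.eventually (hev.and hball)), fun x hx => ?_⟩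
  have hgrow : ∀ n : ℕ, (3 / 2 : ℝ) ^ n * ‖ψ x - e‖ ≤ ‖ψ (x ^ 2 ^ n) - e‖ := by
    intro n
    induction n with
    | zero => simp
    | succ n ih =>
      have h1 := (hx (2 ^ n)).2.1
      rw [ψ.left_inv (hx (2 ^ n)).1, ← pow_two, ← pow_mul, ← pow_succ] at h1
      rw [pow_succ]
      nlinarith
  have h0 : ‖ψ x - e‖ = 0 := by
    by_contra hne
    have hpos : 0 < ‖ψ x - e‖ := lt_of_le_of_ne (norm_nonneg _) (Ne.symm hne)
    obtain ⟨n, hn⟩ := pow_unbounded_of_one_lt (1 / ‖ψ x - e‖) (by norm_num : (1 : ℝ) < 3 / 2)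
    have h1 := (hgrow n).trans_lt (hx (2 ^ n)).2.2
    rw [div_lt_iff₀ hpos] at hn
    linarith
  have h1 : ψ x = ψ 1 := sub_eq_zero.1 (norm_eq_zero.1 h0)
  have hx1 := (hx 1).1
  rw [pow_one] at hx1
  exact ψ.injOn hx1 (mem_extChartAt_source (I := 𝓘(ℝ, E)) (1 : K)) h1

end NoSmallSubgroups

/-! ### Inverse and implicit functions; smooth idempotents. -/

section Calculus

variable {E F : Type*} [NormedAddCommGroup E] [NormedSpace ℝ E] [NormedAddCommGroup F]
  [NormedSpace ℝ F]

/-- The inverse function theorem, with an inverse which is smooth on an open set. -/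
theorem exists_openPartialHomeomorph_contDiffOn_symm [CompleteSpace E] {f : E → F} {O : Set E}
    (hO : IsOpen O) (hf : ContDiffOn ℝ ∞ f O) {a : E} (ha : a ∈ O) {f' : E ≃L[ℝ] F}
    (hf' : HasFDerivAt f (f' : E →L[ℝ] F) a) :
    ∃ e : OpenPartialHomeomorph E F, a ∈ e.source ∧ e.source ⊆ O ∧ (∀ x, e x = f x) ∧
      ContDiffOn ℝ ∞ e.symm e.target := by
  have hfa : ContDiffAt ℝ ∞ f a := hf.contDiffAt (hO.mem_nhds ha)
  let e₀ := hfa.toOpenPartialHomeomorph f hf' (by simp)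
  -- Restricting to points with invertible derivative makes the inverse smooth on its whole domain,
  -- not only at the image of a.
  set O' := O ∩ fderiv ℝ f ⁻¹' Set.range ((↑) : (E ≃L[ℝ] F) → E →L[ℝ] F)
  have hO' : IsOpen O' :=
    (hf.continuousOn_fderiv_of_isOpen hO (by simp)).isOpen_inter_preimage hO
      ContinuousLinearEquiv.isOpen
  have haO' : a ∈ O' := ⟨ha, f', hf'.fderiv.symm⟩
  refine ⟨e₀.restrOpen O' hO', ⟨hfa.mem_toOpenPartialHomeomorph_source hf' (by simp), haO'⟩,
    fun x hx => hx.2.1, fun x => rfl, fun y hy => ?_⟩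
  have hy' := (e₀.restrOpen O' hO').map_target hy
  obtain ⟨T, hT⟩ := hy'.2.2
  have hc : ContDiffAt ℝ ∞ f ((e₀.restrOpen O' hO').symm y) :=
    hf.contDiffAt (hO.mem_nhds hy'.2.1)
  refine ((e₀.restrOpen O' hO').contDiffAt_symm hy (f₀' := T) ?_ hc).contDiffWithinAt
  rw [hT]
  exact (hc.differentiableAt (by simp)).hasFDerivAt

/-- The implicit function theorem, with uniqueness and smoothness on open sets. -/
theorem exists_implicit_function [CompleteSpace E] [CompleteSpace F] {f : E × F → F}
    {O : Set (E × F)} (hO : IsOpen O) (hf : ContDiffOn ℝ ∞ f O) {a : E} {b : F} (hab : (a, b) ∈ O)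
    (h0 : f (a, b) = 0) {T : F ≃L[ℝ] F}
    (hT : HasFDerivAt (fun y => f (a, y)) (T : F →L[ℝ] F) b) :
    ∃ (W : Set (E × F)) (V : Set E) (g : E → F), IsOpen W ∧ W ⊆ O ∧ (a, b) ∈ W ∧ IsOpen V ∧ a ∈ V ∧
      ContDiffOn ℝ ∞ g V ∧ g a = b ∧ (∀ x ∈ V, (x, g x) ∈ W ∧ f (x, g x) = 0) ∧
      ∀ x y y', (x, y) ∈ W → (x, y') ∈ W → f (x, y) = f (x, y') → y = y' := by
  have hfd : HasFDerivAt f (fderiv ℝ f (a, b)) (a, b) :=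
    ((hf.contDiffAt (hO.mem_nhds hab)).differentiableAt (by simp)).hasFDerivAt
  set L := fderiv ℝ f (a, b)
  have hLT : ∀ y, L (0, y) = T y := by
    have h1 : HasFDerivAt (fun y : F => (a, y)) ((0 : F →L[ℝ] E).prod (.id ℝ F)) b :=
      (hasFDerivAt_const a b).prodMk (hasFDerivAt_id b)
    have h2 := (HasFDerivAt.comp (g := f) (f := fun y : F => (a, y)) b hfd h1).unique hT
    intro y
    rw [← ContinuousLinearEquiv.coe_coe, ← h2]
    simp
  have hsplit : ∀ p : E × F, L p = L (p.1, 0) + T p.2 := by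
    intro p
    rw [← hLT, ← map_add]
    simp
  let Φ' : (E × F) ≃L[ℝ] (E × F) := ContinuousLinearEquiv.equivOfInverse
    ((ContinuousLinearMap.fst ℝ E F).prod L)
    ((ContinuousLinearMap.fst ℝ E F).prod ((T.symm : F →L[ℝ] F).comp
      (ContinuousLinearMap.snd ℝ E F - L.comp ((ContinuousLinearMap.fst ℝ E F).prod 0))))
    (fun p => by
      ext
      · simp
      · simp [hsplit p])
    (fun p => by
      ext
      · simp
      · simp only [ContinuousLinearMap.prod_apply]
        rw [hsplit]
        simp)
  have hΦ' : HasFDerivAt (fun p : E × F => (p.1, f p)) (Φ' : E × F →L[ℝ] E × F) (a, b) :=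
    hasFDerivAt_fst.prodMk hfd
  obtain ⟨e, hae, heO, he, hes⟩ := exists_openPartialHomeomorph_contDiffOn_symm hO
    (contDiff_fst.contDiffOn.prodMk hf) hab hΦ'
  have heab : e (a, b) = (a, 0) := by rw [he, h0]
  have hι : Continuous fun x : E => (x, (0 : F)) := by fun_prop
  refine ⟨e.source, (fun x : E => (x, (0 : F))) ⁻¹' e.target, fun x => (e.symm (x, 0)).2,
    e.open_source, heO, hae, e.open_target.preimage hι, ?_, ?_, ?_, ?_, ?_⟩
  · rw [Set.mem_preimage, ← heab]
    exact e.map_source hae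
  · exact contDiff_snd.comp_contDiffOn
      (hes.comp (contDiff_id.prodMk contDiff_const).contDiffOn fun x hx => hx)
  · change (e.symm (a, 0)).2 = b
    rw [← heab, e.left_inv hae]
  · intro x hx
    have h1 := e.right_inv hx
    rw [he] at h1
    have h2 : (x, (e.symm (x, 0)).2) = e.symm (x, 0) := by
      ext
      · exact (congrArg Prod.fst h1).symm
      · rfl
    rw [h2]
    exact ⟨e.map_target hx, congrArg Prod.snd h1⟩
  · intro x y y' h h' hff
    refine congrArg Prod.snd (e.injOn h h' ?_)
    rw [he, he, hff]

/-- A smooth map which is idempotent near a fixed point is, near that point, conjugate to a linear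
projection. Hence its fibres are those of a smooth submersion with a smooth section. -/
theorem exists_submersion_of_idempotent [FiniteDimensional ℝ E] {r : E → E} {O : Set E}
    (hO : IsOpen O) (hr : ContDiffOn ℝ ∞ r O) {a : E} (ha : a ∈ O) (hra : r a = a)
    (hrr : ∀ᶠ v in 𝓝 a, r (r v) = r v) :
    ∃ (d : ℕ) (U : Set E) (D : Set (EuclideanSpace ℝ (Fin d))) (q : E → EuclideanSpace ℝ (Fin d))
      (τ : EuclideanSpace ℝ (Fin d) → E), IsOpen U ∧ a ∈ U ∧ U ⊆ O ∧ IsOpen D ∧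
      ContDiffOn ℝ ∞ q U ∧ ContDiffOn ℝ ∞ τ D ∧ Set.MapsTo q U D ∧ Set.MapsTo τ D U ∧
      (∀ w ∈ D, q (τ w) = w) ∧ τ (q a) = a ∧ ∀ x ∈ U, ∀ y ∈ U, q x = q y ↔ r x = r y := by
  have hca : ContDiffAt ℝ ∞ r a := hr.contDiffAt (hO.mem_nhds ha)
  have hda : HasFDerivAt r (fderiv ℝ r a) a := (hca.differentiableAt (by simp)).hasFDerivAt
  set P := fderiv ℝ r a
  have hPP : ∀ v, P (P v) = P v := by
    have h1 : HasFDerivAt (fun v => r (r v)) (P.comp P) a :=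
      HasFDerivAt.comp (g := r) (f := r) a (by rwa [hra]) hda
    exact DFunLike.congr_fun ((h1.congr_of_eventuallyEq
      (hrr.mono fun v hv => hv.symm)).unique hda)
  -- Write h = P r + (1 - P)(id - r). Its derivative at a is P² + (1 - P)² = id, and h ∘ r = P ∘ r
  -- wherever r is idempotent, so the coordinates h linearise r.
  let h : E → E := fun v => P (r v) + (v - r v) - P (v - r v)
  have hh : ContDiffOn ℝ ∞ h O :=
    ((P.contDiff.comp_contDiffOn hr).add (contDiffOn_id.sub hr)).sub
      (P.contDiff.comp_contDiffOn (contDiffOn_id.sub hr))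
  have hh' : HasFDerivAt h ((ContinuousLinearEquiv.refl ℝ E : E ≃L[ℝ] E) : E →L[ℝ] E) a := by
    have h1 := ((P.hasFDerivAt.comp a hda).add ((hasFDerivAt_id a).sub hda)).sub
      (P.hasFDerivAt.comp a ((hasFDerivAt_id a).sub hda))
    refine h1.congr_fderiv ?_
    ext v
    simp [hPP]
  obtain ⟨e, hae, heO, he, hes⟩ := exists_openPartialHomeomorph_contDiffOn_symm hO hh ha hh'
  have hPh : ∀ v, P (h v) = P (r v) := by
    intro v
    simp [h, hPP]
  have hhr : ∀ v, r (r v) = r v → h (r v) = P (r v) := by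
    intro v hv
    simp [h, hv]
  let V := P.range
  let L : V ≃L[ℝ] EuclideanSpace ℝ (Fin (Module.finrank ℝ V)) := toEuclidean
  let Q : E →L[ℝ] V := P.rangeRestrict
  have hQ : ∀ v, (Q v : E) = P v := fun v => rfl
  have hPV : ∀ w : V, P w = w := by
    rintro ⟨_, v, rfl⟩
    exact hPP v
  let q : E → EuclideanSpace ℝ (Fin (Module.finrank ℝ V)) := fun v => L (Q (r v))
  let j : EuclideanSpace ℝ (Fin (Module.finrank ℝ V)) →L[ℝ] E := V.subtypeL.comp (L.symm : _ →L[ℝ] V)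
  have hjq : ∀ v, j (q v) = P (r v) := by
    intro v
    simp [j, q, hQ]
  obtain ⟨U₀, hU₀, hU₀o, haU₀⟩ : ∃ U₀ ⊆ {v | v ∈ O ∧ r v ∈ e.source ∧ r (r v) = r v},
      IsOpen U₀ ∧ a ∈ U₀ := by
    refine mem_nhds_iff.1 ?_
    have : ∀ᶠ v in 𝓝 a, r v ∈ e.source :=
      hca.continuousAt.eventually (by rw [hra]; exact e.open_source.mem_nhds hae)
    filter_upwards [hO.mem_nhds ha, this, hrr] with v h1 h2 h3 using ⟨h1, h2, h3⟩
  let D : Set (EuclideanSpace ℝ (Fin (Module.finrank ℝ V))) := j ⁻¹' (e.target ∩ e.symm ⁻¹' U₀)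
  have hD : IsOpen D := (e.symm.isOpen_inter_preimage hU₀o).preimage j.continuous
  have hqO : ContDiffOn ℝ ∞ q O := L.contDiff.comp_contDiffOn (Q.contDiff.comp_contDiffOn hr)
  have hqτ : ∀ w ∈ D, q (e.symm (j w)) = w := by
    intro w hw
    have h1 : P (r (e.symm (j w))) = j w := by
      rw [← hPh, ← he, e.right_inv hw.1]
      exact hPV (L.symm w)
    have h2 : Q (r (e.symm (j w))) = L.symm w := Subtype.ext h1
    change L (Q (r (e.symm (j w)))) = w
    rw [h2, L.apply_symm_apply]
  have hqa : j (q a) = e a := by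
    rw [hjq, he, ← hhr a (by rw [hra, hra]), hra]
  refine ⟨_, U₀ ∩ q ⁻¹' D, D, q, fun w => e.symm (j w),
    (hqO.mono fun v hv => (hU₀ hv).1).continuousOn.isOpen_inter_preimage hU₀o hD,
    ⟨haU₀, ?_⟩, fun v hv => (hU₀ hv.1).1, hD, hqO.mono fun v hv => (hU₀ hv.1).1,
    hes.comp j.contDiff.contDiffOn fun w hw => hw.1, fun v hv => hv.2, fun w hw => ⟨hw.2, ?_⟩, hqτ,
    ?_, ?_⟩
  · change j (q a) ∈ e.target ∩ e.symm ⁻¹' U₀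
    rw [hqa]
    exact ⟨e.map_source hae, by rwa [Set.mem_preimage, e.left_inv hae]⟩
  · rw [Set.mem_preimage, hqτ w hw]
    exact hw
  · change e.symm (j (q a)) = a
    rw [hqa, e.left_inv hae]
  · intro x hx y hy
    refine ⟨fun hxy => e.injOn (hU₀ hx.1).2.1 (hU₀ hy.1).2.1 ?_, fun hxy => ?_⟩
    · rw [he, he, hhr x (hU₀ hx.1).2.2, hhr y (hU₀ hy.1).2.2, ← hjq, ← hjq, hxy]
    · change L (Q (r x)) = L (Q (r y))
      rw [hxy]

end Calculus

/-! ### Local rigidity of homomorphisms from a finite group. -/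

section Rigidity

variable {E : Type*} [NormedAddCommGroup E] [NormedSpace ℝ E]
  {K : Type*} [Group K] [TopologicalSpace K] [ChartedSpace E K]

variable (E) in
/-- Conjugation by `k` in the chart at `1`. -/
noncomputable def conjChart (k : K) (v : E) : E :=
  extChartAt 𝓘(ℝ, E) (1 : K) (k * (extChartAt 𝓘(ℝ, E) (1 : K)).symm v * k⁻¹)

variable (E) in
/-- The adjoint representation, in the chart at `1`. -/
noncomputable def adChart (k : K) : E →L[ℝ] E :=
  fderiv ℝ (conjChart E k) (extChartAt 𝓘(ℝ, E) (1 : K) 1)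

theorem conjChart_chart_one (k : K) :
    conjChart E k (extChartAt 𝓘(ℝ, E) (1 : K) 1) = extChartAt 𝓘(ℝ, E) (1 : K) 1 := by
  rw [conjChart, extChartAt_to_inv (I := 𝓘(ℝ, E)) (1 : K), mul_one, mul_inv_cancel]

/-- The sum whose zeros are the elements conjugating `φ` to `ρ`. -/
noncomputable def averagedDefect {A : Type*} [Group A] [Fintype A] (φ : A →* K) (ρ : A → K) (k : K) :
    E :=
  ∑ b, adChart E (φ b⁻¹)
    (extChartAt 𝓘(ℝ, E) (1 : K) (ρ b * k * (φ b)⁻¹) - extChartAt 𝓘(ℝ, E) (1 : K) 1)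

variable [LieGroup 𝓘(ℝ, E) ∞ K]

theorem hasFDerivAt_conjChart (k : K) :
    HasFDerivAt (conjChart E k) (adChart E k) (extChartAt 𝓘(ℝ, E) (1 : K) 1) := by
  have hto : IsOpen (extChartAt 𝓘(ℝ, E) (1 : K)).target := isOpen_extChartAt_target _
  have hso : IsOpen (extChartAt 𝓘(ℝ, E) (1 : K)).source := isOpen_extChartAt_source _
  have hg : ContMDiffOn 𝓘(ℝ, E) 𝓘(ℝ, E) ∞
      (fun v : E => k * (extChartAt 𝓘(ℝ, E) (1 : K)).symm v * k⁻¹)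
      (extChartAt 𝓘(ℝ, E) (1 : K)).target :=
    (contMDiffOn_const.mul contMDiffOn_extChartAt_one_symm).mul contMDiffOn_const
  have hO := hg.continuousOn.isOpen_inter_preimage hto hso
  have h1 := contDiffOn_extChartAt_one_comp (hg.mono Set.inter_subset_left) fun p hp => hp.2
  refine ((h1.contDiffAt (hO.mem_nhds ⟨mem_extChartAt_target _, ?_⟩)).differentiableAt
    (by simp)).hasFDerivAt
  rw [Set.mem_preimage, extChartAt_to_inv (I := 𝓘(ℝ, E)) (1 : K), mul_one, mul_inv_cancel]
  exact mem_extChartAt_source _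

theorem adChart_one : adChart E (1 : K) = .id ℝ E := by
  refine (hasFDerivAt_conjChart (1 : K)).unique ((hasFDerivAt_id _).congr_of_eventuallyEq ?_)
  filter_upwards [extChartAt_target_mem_nhds (I := 𝓘(ℝ, E)) (1 : K)] with v hv
  rw [conjChart, one_mul, inv_one, mul_one, PartialEquiv.right_inv _ hv, id]

theorem adChart_mul (k l : K) : adChart E (k * l) = (adChart E k).comp (adChart E l) := by
  have : IsTopologicalGroup K := topologicalGroup_of_lieGroup 𝓘(ℝ, E) ∞
  have h1 : HasFDerivAt (fun v => conjChart E k (conjChart E l v))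
      ((adChart E k).comp (adChart E l)) (extChartAt 𝓘(ℝ, E) (1 : K) 1) :=
    HasFDerivAt.comp (g := conjChart E k) (f := conjChart E l) _
      (by rw [conjChart_chart_one]; exact hasFDerivAt_conjChart k) (hasFDerivAt_conjChart l)
  refine (hasFDerivAt_conjChart (k * l)).unique (h1.congr_of_eventuallyEq ?_)
  have hc : ContinuousAt (fun v : E => l * (extChartAt 𝓘(ℝ, E) (1 : K)).symm v * l⁻¹)
      (extChartAt 𝓘(ℝ, E) (1 : K) 1) :=
    (continuousAt_const.mul (continuousAt_extChartAt_symm (I := 𝓘(ℝ, E)) (1 : K))).mul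
      continuousAt_const
  have hm : ∀ᶠ v in 𝓝 (extChartAt 𝓘(ℝ, E) (1 : K) 1),
      l * (extChartAt 𝓘(ℝ, E) (1 : K)).symm v * l⁻¹ ∈ (extChartAt 𝓘(ℝ, E) (1 : K)).source := by
    refine hc.eventually ?_
    beta_reduce
    rw [extChartAt_to_inv (I := 𝓘(ℝ, E)) (1 : K), mul_one, mul_inv_cancel]
    exact extChartAt_source_mem_nhds (I := 𝓘(ℝ, E)) (1 : K)
  filter_upwards [hm] with v hv
  simp only [conjChart]
  rw [PartialEquiv.left_inv _ hv]
  congr 1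
  group

variable {A : Type*} [Group A] [Fintype A]

/-- Reindex the sum by b ↦ bc. Consequently k ↦ ρ(c) k φ(c)⁻¹ preserves the zeros of the defect; a
locally unique zero is therefore fixed, that is, ρ(c) k = k φ(c). -/
theorem averagedDefect_equivariant (φ ρ : A →* K) (k : K) (c : A) :
    averagedDefect (E := E) φ ρ (ρ c * k * (φ c)⁻¹) =
      adChart E (φ c) (averagedDefect (E := E) φ ρ k) := by
  rw [averagedDefect, averagedDefect, map_sum]
  refine Fintype.sum_equiv (Equiv.mulRight c) _ _ fun b => ?_
  rw [← ContinuousLinearMap.comp_apply, ← adChart_mul, ← map_mul]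
  simp only [Equiv.coe_mulRight, mul_inv_rev, mul_inv_cancel_left, map_mul, mul_assoc]

/-- The coordinates, around `φ`, of a family of elements of `K`. -/
noncomputable def tupleChart (E : Type*) [NormedAddCommGroup E] [NormedSpace ℝ E] {K : Type*}
    [Group K] [TopologicalSpace K] [ChartedSpace E K] {A : Type*} (φ ρ : A → K) : A → E :=
  fun b => extChartAt 𝓘(ℝ, E) (1 : K) (ρ b * (φ b)⁻¹)

/-- Local rigidity of homomorphisms from a finite group: a homomorphism `ρ` near `φ` is conjugate
to `φ` by an element which depends smoothly on `ρ`. -/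
theorem exists_smooth_conjugator [FiniteDimensional ℝ E] (φ : A →* K) :
    ∃ (V : Set (A → E)) (κ : (A → E) → K), IsOpen V ∧
      (fun _ => extChartAt 𝓘(ℝ, E) (1 : K) 1) ∈ V ∧ ContMDiffOn 𝓘(ℝ, A → E) 𝓘(ℝ, E) ∞ κ V ∧
      κ (fun _ => extChartAt 𝓘(ℝ, E) (1 : K) 1) = 1 ∧
      ∀ ρ : A →* K, (∀ b, ρ b * (φ b)⁻¹ ∈ (extChartAt 𝓘(ℝ, E) (1 : K)).source) →
        tupleChart E φ ρ ∈ V → ∀ c, ρ c * κ (tupleChart E φ ρ) * (φ c)⁻¹ = κ (tupleChart E φ ρ) := by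
  have : IsTopologicalGroup K := topologicalGroup_of_lieGroup 𝓘(ℝ, E) ∞
  set ψ := extChartAt 𝓘(ℝ, E) (1 : K)
  set e := ψ 1
  have hs1 : ψ.symm e = 1 := extChartAt_to_inv (I := 𝓘(ℝ, E)) (1 : K)
  have hto : IsOpen ψ.target := isOpen_extChartAt_target (I := 𝓘(ℝ, E)) (1 : K)
  have hso : IsOpen ψ.source := isOpen_extChartAt_source (I := 𝓘(ℝ, E)) (1 : K)
  have h1s : (1 : K) ∈ ψ.source := mem_extChartAt_source _
  have het : e ∈ ψ.target := mem_extChartAt_target _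
  -- In coordinates u of ρ and v of k, this is ρ(b) k φ(b)⁻¹.
  let m : A → (A → E) × E → K := fun b p => ψ.symm (p.1 b) * φ b * ψ.symm p.2 * (φ b)⁻¹
  let Ω₀ : Set ((A → E) × E) := (Set.univ.pi fun _ => ψ.target) ×ˢ ψ.target
  have hΩ₀ : IsOpen Ω₀ := (isOpen_set_pi Set.finite_univ fun _ _ => hto).prod hto
  have hm : ∀ b, ContMDiffOn 𝓘(ℝ, (A → E) × E) 𝓘(ℝ, E) ∞ (m b) Ω₀ := fun b =>
    (((contMDiffOn_extChartAt_one_symm.comp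
      ((contDiff_apply ℝ E b).comp contDiff_fst).contMDiff.contMDiffOn
        fun p hp => hp.1 b trivial).mul contMDiffOn_const).mul
      (contMDiffOn_extChartAt_one_symm.comp contDiff_snd.contMDiff.contMDiffOn
        fun p hp => hp.2)).mul contMDiffOn_const
  let Ω : Set ((A → E) × E) := ⋂ b, Ω₀ ∩ m b ⁻¹' ψ.source
  have hΩ : IsOpen Ω := isOpen_iInter_of_finite fun b =>
    (hm b).continuousOn.isOpen_inter_preimage hΩ₀ hso
  have hmΩ : ∀ b, ContDiffOn ℝ ∞ (fun p => ψ (m b p)) Ω := fun b =>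
    contDiffOn_extChartAt_one_comp ((hm b).mono fun p hp => (Set.mem_iInter.1 hp b).1)
      fun p hp => (Set.mem_iInter.1 hp b).2
  let f : (A → E) × E → E := fun p => ∑ b, adChart E (φ b⁻¹) (ψ (m b p) - e)
  have hf : ContDiffOn ℝ ∞ f Ω := ContDiffOn.sum fun b _ =>
    (adChart E (φ b⁻¹)).contDiff.comp_contDiffOn ((hmΩ b).sub contDiffOn_const)
  let e' : A → E := fun _ => e
  have hm1 : ∀ b, m b (e', e) = 1 := fun b => by simp [m, e', hs1]
  have hee : (e', e) ∈ Ω := Set.mem_iInter.2 fun b =>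
    ⟨⟨fun _ _ => het, het⟩, by rw [Set.mem_preimage, hm1]; exact h1s⟩
  have hf0 : f (e', e) = 0 := Finset.sum_eq_zero fun b _ => by
    rw [hm1, sub_self, map_zero]
  -- At ρ = φ and k = 1 each summand has derivative Ad(φ(b)⁻¹) Ad(φ(b)) = id, so the sum has the
  -- invertible derivative |A|.
  let T : E ≃L[ℝ] E := ContinuousLinearEquiv.smulLeft
    (Units.mk0 (Fintype.card A : ℝ) (by simp [Fintype.card_ne_zero]))
  have hT : HasFDerivAt (fun v => f (e', v)) (T : E →L[ℝ] E) e := by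
    have h1 : HasFDerivAt (fun v => ∑ b, adChart E (φ b⁻¹) (conjChart E (φ b) v - e))
        (∑ b : A, (adChart E (φ b⁻¹)).comp (adChart E (φ b))) e :=
      HasFDerivAt.fun_sum fun b _ => (adChart E (φ b⁻¹)).hasFDerivAt.comp e
        ((hasFDerivAt_conjChart (φ b)).sub_const e)
    have h2 : (fun v => f (e', v)) =
        fun v => ∑ b, adChart E (φ b⁻¹) (conjChart E (φ b) v - e) := by
      funext v
      simp only [f, m, e', hs1, one_mul]
      rfl
    rw [h2]
    refine h1.congr_fderiv ?_
    simp only [← adChart_mul, ← map_mul, inv_mul_cancel, map_one, adChart_one]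
    ext v
    simp only [T, Finset.sum_const, Finset.card_univ, smul_apply, ContinuousLinearMap.id_apply]
    exact (Nat.cast_smul_eq_nsmul ℝ _ v).symm
  obtain ⟨W, V, g, hW, hWΩ, heW, hV, heV, hg, hge, hgW, hinj⟩ :=
    exists_implicit_function hΩ hf hee hf0 hT
  have hgc : ContinuousAt g e' := (hg.contDiffAt (hV.mem_nhds heV)).continuousAt
  -- The moved zeros ρ(c) k φ(c)⁻¹ must also lie in the region where uniqueness holds.
  have hev : ∀ᶠ u in 𝓝 e', ∀ c, (u, ψ (m c (u, g u))) ∈ W := by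
    refine eventually_all.2 fun c => ?_
    have h1 : ContinuousAt (fun p => ψ (m c p)) (e', e) :=
      ((hmΩ c).contDiffAt (hΩ.mem_nhds hee)).continuousAt
    have h2 : ContinuousAt (fun u => (u, g u)) e' := continuousAt_id.prodMk hgc
    have h3 : ContinuousAt (fun u => ψ (m c (u, g u))) e' :=
      ContinuousAt.comp (g := fun p => ψ (m c p)) (f := fun u => (u, g u)) (by rwa [hge]) h2
    have h4 : ContinuousAt (fun u => (u, ψ (m c (u, g u)))) e' := continuousAt_id.prodMk h3
    refine h4.eventually (hW.mem_nhds ?_)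
    beta_reduce
    rw [hge, hm1]
    exact heW
  obtain ⟨V', hV'ev, hV', heV'⟩ := mem_nhds_iff.1 hev
  refine ⟨V ∩ V', fun u => ψ.symm (g u), hV.inter hV', ⟨heV, heV'⟩, ?_, ?_, ?_⟩
  · refine contMDiffOn_extChartAt_one_symm.comp
      (hg.contMDiffOn.mono Set.inter_subset_left) fun u hu => ?_
    exact (Set.mem_iInter.1 (hWΩ (hgW u hu.1).1) 1).1.2
  · change ψ.symm (g e') = 1
    rw [hge, hs1]
  · intro ρ hρ hρV c
    set u := tupleChart E φ ρ
    have hmu : ∀ b v, m b (u, v) = ρ b * ψ.symm v * (φ b)⁻¹ := by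
      intro b v
      have : ψ.symm (u b) = ρ b * (φ b)⁻¹ := ψ.left_inv (hρ b)
      simp only [m, this]
      group
    have hfu : ∀ v, f (u, v) = averagedDefect φ ρ (ψ.symm v) := by
      intro v
      simp only [f, hmu, averagedDefect]
      rfl
    have hgu := hgW u hρV.1
    have hms : m c (u, g u) ∈ ψ.source := (Set.mem_iInter.1 (hWΩ hgu.1) c).2
    have hmψ : ψ.symm (ψ (m c (u, g u))) = ρ c * ψ.symm (g u) * (φ c)⁻¹ := by
      rw [ψ.left_inv hms, hmu]
    have key := hinj u (ψ (m c (u, g u))) (g u) (hV'ev hρV.2 c) hgu.1 (by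
      rw [hgu.2, hfu, hmψ, averagedDefect_equivariant, ← hfu, hgu.2, map_zero])
    rw [← hmψ, key]

/-- Near `1`, the conjugates `xφx⁻¹` can be written with a conjugating element that depends only on
the conjugate, and smoothly on `x`. -/
theorem exists_smooth_conj_retraction [FiniteDimensional ℝ E] (φ : A →* K) :
    ∃ (U : Set K) (σ : K → K), IsOpen U ∧ (1 : K) ∈ U ∧ ContMDiffOn 𝓘(ℝ, E) 𝓘(ℝ, E) ∞ σ U ∧
      σ 1 = 1 ∧ (∀ x ∈ U, ∀ a, σ x * φ a * (σ x)⁻¹ = x * φ a * x⁻¹) ∧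
      ∀ x y, (∀ a, x * φ a * x⁻¹ = y * φ a * y⁻¹) → σ x = σ y := by
  obtain ⟨V, κ, hV, heV, hκ, hκe, hκV⟩ := exists_smooth_conjugator (E := E) φ
  set ψ := extChartAt 𝓘(ℝ, E) (1 : K)
  let c : K → A → K := fun x a => x * φ a * x⁻¹
  have hc1 : ∀ a, ContMDiff 𝓘(ℝ, E) 𝓘(ℝ, E) ∞ fun x : K => c x a * (φ a)⁻¹ := fun a =>
    ((contMDiff_id.mul contMDiff_const).mul contMDiff_id.inv).mul contMDiff_const
  let O : Set K := ⋂ a, (fun x : K => c x a * (φ a)⁻¹) ⁻¹' ψ.source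
  have hO : IsOpen O := isOpen_iInter_of_finite fun a =>
    (isOpen_extChartAt_source _).preimage (hc1 a).continuous
  have ht : ContMDiffOn 𝓘(ℝ, E) 𝓘(ℝ, A → E) ∞ (fun x => tupleChart E φ (c x)) O :=
    contMDiffOn_pi_space.2 fun a =>
      contMDiffOn_extChartAt_one.comp (hc1 a).contMDiffOn fun x hx => Set.mem_iInter.1 hx a
  have ht1 : tupleChart E φ (c 1) = fun _ => ψ 1 := by
    funext a
    simp [tupleChart, c, ψ]
  refine ⟨O ∩ (fun x => tupleChart E φ (c x)) ⁻¹' V, fun x => κ (tupleChart E φ (c x)),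
    ht.continuousOn.isOpen_inter_preimage hO hV, ⟨Set.mem_iInter.2 fun a => ?_, ?_⟩,
    hκ.comp (ht.mono Set.inter_subset_left) fun x hx => hx.2, ?_, ?_, ?_⟩
  · simp [c, ψ]
  · rwa [Set.mem_preimage, ht1]
  · change κ (tupleChart E φ (c 1)) = 1
    rw [ht1, hκe]
  · intro x hx a
    have h := hκV ((MulAut.conj x).toMonoidHom.comp φ) (fun b => Set.mem_iInter.1 hx.1 b) hx.2 a
    change c x a * κ (tupleChart E φ (c x)) * (φ a)⁻¹ = κ (tupleChart E φ (c x)) at h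
    exact mul_inv_eq_iff_eq_mul.2 (mul_inv_eq_iff_eq_mul.1 h).symm
  · intro x y h
    have : c x = c y := funext h
    change κ (tupleChart E φ (c x)) = _
    rw [this]

end Rigidity

/-! ### Slices: submersions with a section and prescribed fibres. -/

/-- A submersion of a neighbourhood of `1` in `G` onto an open subset of `ℝ^d`, with a smooth section,
whose fibres are those of `f`. -/
structure LocalSlice (E : Type*) [NormedAddCommGroup E] [NormedSpace ℝ E] {G : Type*} [Group G]
    [TopologicalSpace G] [ChartedSpace E G] {Y : Type*} (f : G → Y) (d : ℕ) where
  source : Set G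
  target : Set (EuclideanSpace ℝ (Fin d))
  toFun : G → EuclideanSpace ℝ (Fin d)
  invFun : EuclideanSpace ℝ (Fin d) → G
  isOpen_source : IsOpen source
  isOpen_target : IsOpen target
  one_mem : 1 ∈ source
  contMDiffOn_toFun : ContMDiffOn 𝓘(ℝ, E) (𝓡 d) ∞ toFun source
  contMDiffOn_invFun : ContMDiffOn (𝓡 d) 𝓘(ℝ, E) ∞ invFun target
  mapsTo_toFun : Set.MapsTo toFun source target
  mapsTo_invFun : Set.MapsTo invFun target source
  right_inv : ∀ w ∈ target, toFun (invFun w) = w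
  inv_one : invFun (toFun 1) = 1
  eq_iff : ∀ x ∈ source, ∀ y ∈ source, toFun x = toFun y ↔ f x = f y

namespace LocalSlice

variable {E : Type*} [NormedAddCommGroup E] [NormedSpace ℝ E] {G : Type*} [Group G]
    [TopologicalSpace G] [ChartedSpace E G] {Y Y' : Type*} {f : G → Y} {f' : G → Y'} {d : ℕ}

/-- Restrict a slice to an open neighbourhood of `1`, where `f` may be replaced by a map with
the same fibres. -/
def restr (S : LocalSlice E f d) {O : Set G} (hO : IsOpen O) (h1 : 1 ∈ O)
    (hf : ∀ x ∈ S.source ∩ O, ∀ y ∈ S.source ∩ O, f x = f y ↔ f' x = f' y) :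
    LocalSlice E f' d where
  source := (S.source ∩ O) ∩ S.toFun ⁻¹' (S.target ∩ S.invFun ⁻¹' O)
  target := S.target ∩ S.invFun ⁻¹' O
  toFun := S.toFun
  invFun := S.invFun
  isOpen_source := (S.contMDiffOn_toFun.continuousOn.mono
    Set.inter_subset_left).isOpen_inter_preimage (S.isOpen_source.inter hO)
      (S.contMDiffOn_invFun.continuousOn.isOpen_inter_preimage S.isOpen_target hO)
  isOpen_target := S.contMDiffOn_invFun.continuousOn.isOpen_inter_preimage S.isOpen_target hO
  one_mem := ⟨⟨S.one_mem, h1⟩, S.mapsTo_toFun S.one_mem, by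
    rw [Set.mem_preimage, S.inv_one]
    exact h1⟩
  contMDiffOn_toFun := S.contMDiffOn_toFun.mono fun x hx => hx.1.1
  contMDiffOn_invFun := S.contMDiffOn_invFun.mono fun x hx => hx.1
  mapsTo_toFun := fun x hx => hx.2
  mapsTo_invFun := fun w hw => ⟨⟨S.mapsTo_invFun hw.1, hw.2⟩, by
    rw [Set.mem_preimage, S.right_inv w hw.1]
    exact hw⟩
  right_inv := fun w hw => S.right_inv w hw.1
  inv_one := S.inv_one
  eq_iff := fun x hx y hy => (S.eq_iff x hx.1.1 y hy.1.1).trans (hf x hx.1 y hy.1)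

theorem restr_source_subset (S : LocalSlice E f d) {O : Set G} (hO : IsOpen O) (h1 : 1 ∈ O)
    (hf : ∀ x ∈ S.source ∩ O, ∀ y ∈ S.source ∩ O, f x = f y ↔ f' x = f' y) :
    (S.restr hO h1 hf).source ⊆ O :=
  fun _ hx => hx.1.2

end LocalSlice

/-! ### Slices for conjugation of homomorphisms. -/

section LieGroup

variable {E : Type*} [NormedAddCommGroup E] [NormedSpace ℝ E]
  {K : Type*} [Group K] [TopologicalSpace K] [ChartedSpace E K] [LieGroup 𝓘(ℝ, E) ∞ K]

/-- The conjugation action of a Lie group on a homomorphism from a finite group has a slice. -/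
theorem exists_localSlice_conj [FiniteDimensional ℝ E] {A : Type*} [Group A] [Finite A]
    (φ : A →* K) : ∃ d, Nonempty (LocalSlice E (fun (x : K) a => x * φ a * x⁻¹) d) := by
  cases nonempty_fintype A
  obtain ⟨U, σ, hU, h1U, hσ, hσ1, hσc, hσe⟩ := exists_smooth_conj_retraction (E := E) φ
  set ψ := extChartAt 𝓘(ℝ, E) (1 : K)
  have hs1 : ψ.symm (ψ 1) = 1 := extChartAt_to_inv (I := 𝓘(ℝ, E)) (1 : K)
  have hto : IsOpen ψ.target := isOpen_extChartAt_target (I := 𝓘(ℝ, E)) (1 : K)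
  have hso : IsOpen ψ.source := isOpen_extChartAt_source (I := 𝓘(ℝ, E)) (1 : K)
  have h1s : (1 : K) ∈ ψ.source := mem_extChartAt_source _
  let O : Set E := ψ.target ∩ ψ.symm ⁻¹' (U ∩ σ ⁻¹' ψ.source)
  have hO : IsOpen O := contMDiffOn_extChartAt_one_symm.continuousOn.isOpen_inter_preimage hto
    (hσ.continuousOn.isOpen_inter_preimage hU hso)
  have h1O : ψ 1 ∈ O := by
    refine ⟨ψ.map_source h1s, ?_⟩
    rw [Set.mem_preimage, hs1]
    exact ⟨h1U, by rwa [Set.mem_preimage, hσ1]⟩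
  -- σ(x) conjugates φ as x does, and σ depends only on the conjugate, so σ ∘ σ = σ near 1 and the
  -- fibres of σ are those of x ↦ xφx⁻¹.
  let r : E → E := fun v => ψ (σ (ψ.symm v))
  have hr : ContDiffOn ℝ ∞ r O := contDiffOn_extChartAt_one_comp
    (hσ.comp (contMDiffOn_extChartAt_one_symm.mono Set.inter_subset_left) fun v hv => hv.2.1)
    fun v hv => hv.2.2
  have hr1 : r (ψ 1) = ψ 1 := by
    change ψ (σ (ψ.symm (ψ 1))) = ψ 1
    rw [hs1, hσ1]
  have hrr : ∀ v ∈ O, r (r v) = r v := by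
    intro v hv
    change ψ (σ (ψ.symm (ψ (σ (ψ.symm v))))) = ψ (σ (ψ.symm v))
    rw [ψ.left_inv hv.2.2, hσe _ _ (hσc _ hv.2.1)]
  obtain ⟨d, V, D, q, τ, hV, h1V, hVO, hD, hq, hτ, hqD, hτV, hqτ, hτq, hqr⟩ :=
    exists_submersion_of_idempotent hO hr h1O hr1 (eventually_of_mem (hO.mem_nhds h1O) hrr)
  refine ⟨d, ⟨{
    source := ψ.source ∩ ψ ⁻¹' V
    target := D
    toFun := fun x => q (ψ x)
    invFun := fun w => ψ.symm (τ w)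
    isOpen_source := contMDiffOn_extChartAt_one.continuousOn.isOpen_inter_preimage hso hV
    isOpen_target := hD
    one_mem := ⟨h1s, h1V⟩
    contMDiffOn_toFun := hq.contMDiffOn.comp
      (contMDiffOn_extChartAt_one.mono Set.inter_subset_left) fun x hx => hx.2
    contMDiffOn_invFun := contMDiffOn_extChartAt_one_symm.comp hτ.contMDiffOn
      fun w hw => (hVO (hτV hw)).1
    mapsTo_toFun := fun x hx => hqD hx.2
    mapsTo_invFun := fun w hw => ⟨ψ.map_target (hVO (hτV hw)).1, by
      rw [Set.mem_preimage, ψ.right_inv (hVO (hτV hw)).1]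
      exact hτV hw⟩
    right_inv := fun w hw => by rw [ψ.right_inv (hVO (hτV hw)).1, hqτ w hw]
    inv_one := by rw [hτq, hs1]
    eq_iff := fun x hx y hy => by
      have hxO := (hVO hx.2).2
      have hyO := (hVO hy.2).2
      rw [Set.mem_preimage, ψ.left_inv hx.1] at hxO
      rw [Set.mem_preimage, ψ.left_inv hy.1] at hyO
      rw [hqr _ hx.2 _ hy.2]
      change ψ (σ (ψ.symm (ψ x))) = ψ (σ (ψ.symm (ψ y))) ↔ _
      rw [ψ.left_inv hx.1, ψ.left_inv hy.1, ψ.injOn.eq_iff hxO.2 hyO.2]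
      refine ⟨fun h => funext fun a => ?_, fun h => hσe _ _ (congrFun h)⟩
      rw [← hσc x hxO.1, ← hσc y hyO.1, h] }⟩⟩

theorem contMDiffAt_identityComponent_of_val {F H M : Type*} [NormedAddCommGroup F]
    [NormedSpace ℝ F] [TopologicalSpace H] [TopologicalSpace M] [ChartedSpace H M]
    {I : ModelWithCorners ℝ F H} {f : M → identityComponent E K} {x : M}
    (hf : ContMDiffAt I 𝓘(ℝ, E) ∞ (fun x => (f x : K)) x) : ContMDiffAt I 𝓘(ℝ, E) ∞ f x := by
  have h := contMDiffAt_iff.1 hf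
  exact contMDiffAt_iff.2 ⟨Topology.IsInducing.subtypeVal.continuousAt_iff.2 h.1, h.2⟩

open Classical in
/-- A slice contained in the identity component is a slice for the identity component. -/
noncomputable def LocalSlice.toIdentityComponent {Y : Type*} {f : K → Y} {d : ℕ}
    (S : LocalSlice E f d) (hS : ∀ x ∈ S.source, x ∈ identityComponent E K) :
    LocalSlice E (fun x : identityComponent E K => f x) d where
  source := (fun x : identityComponent E K => (x : K)) ⁻¹' S.source
  target := S.target
  toFun := fun x => S.toFun x
  -- The value 1 is only a default: on the target the section lands in K°.
  invFun := fun w => if h : S.invFun w ∈ identityComponent E K then ⟨S.invFun w, h⟩ else 1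
  isOpen_source := S.isOpen_source.preimage continuous_subtype_val
  isOpen_target := S.isOpen_target
  one_mem := S.one_mem
  contMDiffOn_toFun := S.contMDiffOn_toFun.comp
    (contMDiff_identityComponent_val E K).contMDiffOn fun x hx => hx
  contMDiffOn_invFun := fun w hw => by
    refine (contMDiffAt_identityComponent_of_val ?_).contMDiffWithinAt
    refine (S.contMDiffOn_invFun.contMDiffAt (S.isOpen_target.mem_nhds hw)).congr_of_eventuallyEq ?_
    filter_upwards [S.isOpen_target.mem_nhds hw] with w hw
    rw [dif_pos (hS _ (S.mapsTo_invFun hw))]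
  mapsTo_toFun := fun x hx => S.mapsTo_toFun hx
  mapsTo_invFun := fun w hw => by
    rw [Set.mem_preimage]
    beta_reduce
    rw [dif_pos (hS _ (S.mapsTo_invFun hw))]
    exact S.mapsTo_invFun hw
  right_inv := fun w hw => by
    rw [dif_pos (hS _ (S.mapsTo_invFun hw))]
    exact S.right_inv w hw
  inv_one := by
    have h := S.inv_one
    rw [dif_pos (by rw [OneMemClass.coe_one, h]; exact (identityComponent E K).one_mem)]
    exact Subtype.ext h
  eq_iff := fun x hx y hy => S.eq_iff x hx y hy

end LieGroup

/-! ### Topology of a disjoint union of homogeneous spaces. -/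

section OrbitTopology

variable (G : Type*) [Group G] [TopologicalSpace G] (X : Type*) [MulAction G X]

/-- The finest topology for which all orbit maps are continuous: the sum, over the orbits, of the
quotient topologies. -/
@[reducible]
def orbitTopology : TopologicalSpace X where
  IsOpen U := ∀ x : X, IsOpen ((fun k : G => k • x) ⁻¹' U)
  isOpen_univ x := isOpen_univ
  isOpen_inter U V hU hV x := (hU x).inter (hV x)
  isOpen_sUnion s hs x := by
    rw [Set.preimage_sUnion]
    exact isOpen_biUnion fun U hU => hs U hU x

variable {G X}

theorem continuous_smul_orbitTopology (x : X) :
    @Continuous _ _ _ (orbitTopology G X) fun k : G => k • x :=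
  letI := orbitTopology G X
  ⟨fun _ hU => hU x⟩

theorem isOpen_orbit_orbitTopology (x : X) : @IsOpen _ (orbitTopology G X) (MulAction.orbit G x) := by
  intro y
  by_cases hy : y ∈ MulAction.orbit G x
  · convert isOpen_univ
    exact Set.eq_univ_of_forall fun k => MulAction.mem_orbit_of_mem_orbit k hy
  · convert isOpen_empty
    refine Set.eq_empty_of_forall_notMem fun k hk => hy ?_
    have := MulAction.mem_orbit_of_mem_orbit k⁻¹ hk
    rwa [inv_smul_smul] at this

/-- Pulled back to G, the image of V is a union of translates of V, indexed by the stabilizer. -/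
theorem isOpenMap_smul_orbitTopology [IsTopologicalGroup G] (x : X) :
    @IsOpenMap _ _ _ (orbitTopology G X) fun k : G => k • x := by
  intro V hV y
  by_cases hy : y ∈ MulAction.orbit G x
  · obtain ⟨g, rfl⟩ := hy
    have : (fun k : G => k • g • x) ⁻¹' ((fun k : G => k • x) '' V) =
        ⋃ n ∈ MulAction.stabilizer G x, (fun k => k * g * n) ⁻¹' V := by
      ext k
      simp only [Set.mem_preimage, Set.mem_image, Set.mem_iUnion, MulAction.mem_stabilizer_iff,
        exists_prop]
      constructor
      · rintro ⟨l, hl, h⟩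
        refine ⟨(k * g)⁻¹ * l, ?_, by rwa [mul_inv_cancel_left]⟩
        rw [mul_smul, h, ← mul_smul k g x, inv_smul_smul]
      · rintro ⟨n, hn, h⟩
        exact ⟨_, h, by rw [mul_smul, hn, mul_smul]⟩
    change IsOpen ((fun k : G => k • g • x) ⁻¹' ((fun k : G => k • x) '' V))
    rw [this]
    exact isOpen_biUnion fun n _ => hV.preimage (by fun_prop)
  · convert isOpen_empty
    refine Set.eq_empty_of_forall_notMem ?_
    rintro k ⟨l, -, hl⟩
    refine hy ⟨k⁻¹ * l, ?_⟩
    change (k⁻¹ * l) • x = y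
    rw [mul_smul]
    exact inv_smul_eq_iff.2 hl

/-- Points of one orbit are separated because the stabilizer is closed; distinct orbits are open and
disjoint. -/
theorem t2Space_orbitTopology [IsTopologicalGroup G]
    (h : ∀ x : X, IsClosed (MulAction.stabilizer G x : Set G)) : @T2Space X (orbitTopology G X) := by
  let _ := orbitTopology G X
  refine ⟨fun x y hxy => ?_⟩
  by_cases hy : y ∈ MulAction.orbit G x
  · obtain ⟨g, rfl⟩ := hy
    have hcl : IsClosed ((fun p : G × G => p.1⁻¹ * p.2) ⁻¹' (MulAction.stabilizer G x)) :=
      (h x).preimage (by fun_prop)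
    have hmem : ((1, g) : G × G) ∈ ((fun p : G × G => p.1⁻¹ * p.2) ⁻¹'
        (MulAction.stabilizer G x))ᶜ := by
      intro hg
      have : (1 : G)⁻¹ * g ∈ MulAction.stabilizer G x := hg
      rw [inv_one, one_mul, MulAction.mem_stabilizer_iff] at this
      exact hxy this.symm
    obtain ⟨V, W, hV, hW, h1, hg, hVW⟩ := isOpen_prod_iff.1 hcl.isOpen_compl 1 g hmem
    refine ⟨_, _, isOpenMap_smul_orbitTopology x V hV, isOpenMap_smul_orbitTopology x W hW,
      ⟨1, h1, one_smul _ _⟩, ⟨g, hg, rfl⟩, Set.disjoint_left.2 ?_⟩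
    rintro _ ⟨k, hk, rfl⟩ ⟨l, hl, hkl⟩
    refine hVW (Set.mk_mem_prod hk hl) ?_
    change k⁻¹ * l ∈ MulAction.stabilizer G x
    rw [MulAction.mem_stabilizer_iff, mul_smul]
    exact inv_smul_eq_iff.2 hkl
  · refine ⟨_, _, isOpen_orbit_orbitTopology (G := G) x, isOpen_orbit_orbitTopology (G := G) y,
      MulAction.mem_orbit_self x, MulAction.mem_orbit_self y, Set.disjoint_left.2 fun z hx hz => ?_⟩
    exact hy (by rw [← MulAction.orbit_eq_iff.2 hx, MulAction.orbit_eq_iff.2 hz]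
                 exact MulAction.mem_orbit_self y)

/-- The space is an open quotient of finitely many copies of G. -/
theorem secondCountable_orbitTopology [IsTopologicalGroup G] [SecondCountableTopology G]
    [Finite (MulAction.orbitRel.Quotient G X)] :
    @SecondCountableTopology X (orbitTopology G X) := by
  let _ := orbitTopology G X
  let π : (Σ _ : MulAction.orbitRel.Quotient G X, G) → X := fun p => p.2 • p.1.out
  have hc : Continuous π := continuous_sigma fun C => continuous_smul_orbitTopology C.out
  have ho : IsOpenMap π := isOpenMap_sigma.2 fun C => isOpenMap_smul_orbitTopology C.out
  have hs : Function.Surjective π := by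
    intro x
    have : (MulAction.orbitRel G X) x (Quotient.mk'' x : MulAction.orbitRel.Quotient G X).out :=
      (MulAction.orbitRel G X).symm (Quotient.mk_out (s := MulAction.orbitRel G X) x)
    obtain ⟨g, hg⟩ := MulAction.orbitRel_apply.1 this
    exact ⟨⟨_, g⟩, hg⟩
  exact (ho.isQuotientMap hc hs).secondCountableTopology ho

theorem connectedComponent_orbitTopology [ConnectedSpace G] (x : X) :
    @connectedComponent X (orbitTopology G X) x = MulAction.orbit G x := by
  let _ := orbitTopology G X
  refine Set.Subset.antisymm ?_ ?_
  · have hcl : IsClosed (MulAction.orbit G x) := by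
      rw [← isOpen_compl_iff]
      have : (MulAction.orbit G x)ᶜ = ⋃ y ∈ (MulAction.orbit G x)ᶜ, MulAction.orbit G y := by
        ext z
        simp only [Set.mem_iUnion, Set.mem_compl_iff, exists_prop]
        refine ⟨fun hz => ⟨z, hz, MulAction.mem_orbit_self z⟩, ?_⟩
        rintro ⟨y, hy, hz⟩ hzx
        exact hy (by rw [← MulAction.orbit_eq_iff.2 hzx, MulAction.orbit_eq_iff.2 hz]
                     exact MulAction.mem_orbit_self y)
      rw [this]
      exact isOpen_biUnion fun y _ => isOpen_orbit_orbitTopology (G := G) y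
    exact IsClopen.connectedComponent_subset ⟨hcl, isOpen_orbit_orbitTopology x⟩
      (MulAction.mem_orbit_self x)
  · exact (isPreconnected_range (continuous_smul_orbitTopology x)).subset_connectedComponent
      (MulAction.mem_orbit_self x)

end OrbitTopology

/-! ### The atlas of a homogeneous space defined by a slice. -/

namespace LocalSlice

variable {E : Type*} [NormedAddCommGroup E] [NormedSpace ℝ E] {G : Type*} [Group G]
  [TopologicalSpace G] [ChartedSpace E G] {Y : Type*} [MulAction G Y] {y₀ : Y} {d : ℕ}
  (S : LocalSlice E (fun k : G => k • y₀) d)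

open Classical in
/-- The coordinates around `g • y₀` of a homogeneous space which is given by a slice. -/
noncomputable def coord (g : G) (y : Y) : EuclideanSpace ℝ (Fin d) :=
  -- The choice of k is immaterial because `toFun` has the fibres of the orbit map; 0 is a default
  -- off the chart domain.
  if h : ∃ k ∈ S.source, (g * k) • y₀ = y then S.toFun h.choose else 0

theorem coord_smul (g : G) {k : G} (hk : k ∈ S.source) : S.coord g ((g * k) • y₀) = S.toFun k := by
  have h : ∃ l ∈ S.source, (g * l) • y₀ = (g * k) • y₀ := ⟨k, hk, rfl⟩
  rw [coord, dif_pos h]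
  refine (S.eq_iff _ h.choose_spec.1 _ hk).2 ?_
  refine smul_left_cancel g ?_
  simpa only [mul_smul] using h.choose_spec.2

theorem contMDiffAt_invFun {w : EuclideanSpace ℝ (Fin d)} (hw : w ∈ S.target) :
    ContMDiffAt (𝓡 d) 𝓘(ℝ, E) ∞ S.invFun w :=
  S.contMDiffOn_invFun.contMDiffAt (S.isOpen_target.mem_nhds hw)

variable [TopologicalSpace Y] [IsTopologicalGroup G]

/-- The chart around `g • y₀` as an open partial homeomorphism. -/
noncomputable def chart (hc : Continuous fun k : G => k • y₀)
    (ho : IsOpenMap fun k : G => k • y₀) (g : G) :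
    OpenPartialHomeomorph Y (EuclideanSpace ℝ (Fin d)) where
  toFun := S.coord g
  invFun := fun w => (g * S.invFun w) • y₀
  source := (fun k => (g * k) • y₀) '' S.source
  target := S.target
  map_source' := by
    rintro _ ⟨k, hk, rfl⟩
    rw [S.coord_smul g hk]
    exact S.mapsTo_toFun hk
  map_target' := fun w hw => ⟨_, S.mapsTo_invFun hw, rfl⟩
  left_inv' := by
    rintro _ ⟨k, hk, rfl⟩
    have hw := S.mapsTo_toFun hk
    have := (S.eq_iff _ (S.mapsTo_invFun hw) k hk).1 (S.right_inv _ hw)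
    simp only [S.coord_smul g hk]
    rw [mul_smul, mul_smul, this]
  right_inv' := fun w hw => by rw [S.coord_smul g (S.mapsTo_invFun hw), S.right_inv w hw]
  open_source := (ho.comp (isOpenMap_mul_left g)) _ S.isOpen_source
  open_target := S.isOpen_target
  continuousOn_toFun := by
    have ho' : IsOpenMap fun k : G => (g * k) • y₀ := ho.comp (isOpenMap_mul_left g)
    rw [continuousOn_open_iff (ho' _ S.isOpen_source)]
    intro T hT
    have : (fun k => (g * k) • y₀) '' S.source ∩ S.coord g ⁻¹' T =
        (fun k => (g * k) • y₀) '' (S.source ∩ S.toFun ⁻¹' T) := by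
      ext y
      constructor
      · rintro ⟨⟨k, hk, rfl⟩, h⟩
        refine ⟨k, ⟨hk, ?_⟩, rfl⟩
        rwa [Set.mem_preimage, S.coord_smul g hk] at h
      · rintro ⟨k, ⟨hk, h⟩, rfl⟩
        refine ⟨⟨k, hk, rfl⟩, ?_⟩
        rwa [Set.mem_preimage, S.coord_smul g hk]
    rw [this]
    exact ho' _ (S.contMDiffOn_toFun.continuousOn.isOpen_inter_preimage S.isOpen_source hT)
  continuousOn_invFun := hc.comp_continuousOn
    (continuousOn_const.mul S.contMDiffOn_invFun.continuousOn)

variable (hc : Continuous fun k : G => k • y₀) (ho : IsOpenMap fun k : G => k • y₀)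

theorem mem_chart_source (g : G) : g • y₀ ∈ (S.chart hc ho g).source :=
  ⟨1, S.one_mem, by simp⟩

/-- A slice defines an atlas of a homogeneous space. -/
@[reducible]
noncomputable def chartedSpace (hs : Function.Surjective fun k : G => k • y₀) :
    ChartedSpace (EuclideanSpace ℝ (Fin d)) Y where
  atlas := Set.range (S.chart hc ho)
  chartAt y := S.chart hc ho (hs y).choose
  mem_chart_source y := by
    have := S.mem_chart_source hc ho (hs y).choose
    rwa [show (hs y).choose • y₀ = y from (hs y).choose_spec] at this
  chart_mem_atlas y := ⟨_, rfl⟩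

/-- A smooth lift to G suffices for smoothness in the charts. Both the smoothness of the transition
maps and that of the action reduce to this. -/
theorem contMDiffAt_chart_smul [LieGroup 𝓘(ℝ, E) ∞ G] {F H M : Type*} [NormedAddCommGroup F]
    [NormedSpace ℝ F] [TopologicalSpace H] [TopologicalSpace M] [ChartedSpace H M]
    {I : ModelWithCorners ℝ F H} {f : M → G} {x : M} (hf : ContMDiffAt I 𝓘(ℝ, E) ∞ f x) (g : G)
    (hx : f x • y₀ ∈ (S.chart hc ho g).source) :
    ContMDiffAt I (𝓡 d) ∞ (fun m => S.chart hc ho g (f m • y₀)) x := by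
  obtain ⟨u, hu, hux⟩ := hx
  have hux' : (g * u) • y₀ = f x • y₀ := hux
  -- The correction n fixes y₀ and moves the lift, after translation by g⁻¹, into the domain of the
  -- slice.
  set n : G := (f x)⁻¹ * (g * u)
  have hn : n • y₀ = y₀ := by rw [mul_smul, hux', inv_smul_smul]
  let v : M → G := fun m => g⁻¹ * f m * n
  have hv : ContMDiffAt I 𝓘(ℝ, E) ∞ v x :=
    (contMDiffAt_const.mul hf).mul contMDiffAt_const
  have hvx : v x = u := by simp [v, n, mul_assoc]
  have hvs : ∀ᶠ m in 𝓝 x, v m ∈ S.source :=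
    hv.continuousAt.eventually (by rw [hvx]; exact S.isOpen_source.mem_nhds hu)
  have hS : ContMDiffAt 𝓘(ℝ, E) (𝓡 d) ∞ S.toFun (v x) := by
    rw [hvx]
    exact S.contMDiffOn_toFun.contMDiffAt (S.isOpen_source.mem_nhds hu)
  refine (hS.comp x hv).congr_of_eventuallyEq ?_
  filter_upwards [hvs] with m hm
  have : f m • y₀ = (g * v m) • y₀ := by
    simp only [v, mul_assoc, mul_inv_cancel_left]
    rw [mul_smul, hn]
  rw [this]
  exact S.coord_smul g hm

theorem isManifold [LieGroup 𝓘(ℝ, E) ∞ G] (hs : Function.Surjective fun k : G => k • y₀) :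
    letI := S.chartedSpace hc ho hs
    IsManifold (𝓡 d) ∞ Y := by
  let _ := S.chartedSpace hc ho hs
  refine isManifold_of_contDiffOn (𝓡 d) ∞ Y ?_
  rintro _ _ ⟨g, rfl⟩ ⟨g', rfl⟩
  intro w hw
  have hw' : w ∈ S.target ∧ (g * S.invFun w) • y₀ ∈ (S.chart hc ho g').source := by
    have := hw.1
    rw [Set.mem_preimage, OpenPartialHomeomorph.trans_source] at this
    exact this
  refine ContDiffAt.contDiffWithinAt (ContMDiffAt.contDiffAt ?_)
  exact S.contMDiffAt_chart_smul hc ho (f := fun w => g * S.invFun w)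
    (contMDiffAt_const.mul (S.contMDiffAt_invFun hw'.1)) g' hw'.2

theorem contMDiffSMul [LieGroup 𝓘(ℝ, E) ∞ G] (hs : Function.Surjective fun k : G => k • y₀) :
    letI := S.chartedSpace hc ho hs
    ContMDiffSMul 𝓘(ℝ, E) (𝓡 d) ∞ G Y := by
  let _ := S.chartedSpace hc ho hs
  have := S.isManifold hc ho hs
  refine ⟨fun ⟨k, y⟩ => ?_⟩
  let e := chartAt (EuclideanSpace ℝ (Fin d)) y
  let g := (hs y).choose
  have he : e = S.chart hc ho g := rfl
  have hye : y ∈ e.source := _root_.mem_chart_source _ y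
  -- A local lift of the action map to G, through the section of the chart at y.
  let f : G × Y → G := fun p => p.1 * (g * S.invFun (e p.2))
  have hfe : ∀ p : G × Y, p.2 ∈ e.source → f p • y₀ = p.1 • p.2 := by
    intro p hp
    change (p.1 * (g * S.invFun (e p.2))) • y₀ = p.1 • p.2
    rw [mul_smul]
    congr 1
    exact e.left_inv hp
  have hece : ContMDiffAt (𝓡 d) (𝓡 d) ∞ e y := contMDiffAt_extChartAt (I := 𝓡 d) (x := y)
  have hf : ContMDiffAt (𝓘(ℝ, E).prod (𝓡 d)) 𝓘(ℝ, E) ∞ f (k, y) := by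
    refine contMDiffAt_fst.mul (contMDiffAt_const.mul ?_)
    have h1 : ContMDiffAt (𝓘(ℝ, E).prod (𝓡 d)) (𝓡 d) ∞ (fun p : G × Y => e p.2) (k, y) :=
      ContMDiffAt.comp (g := e) (f := fun p : G × Y => p.2) (k, y) hece contMDiffAt_snd
    exact ContMDiffAt.comp (g := S.invFun) (f := fun p : G × Y => e p.2) (k, y)
      (S.contMDiffAt_invFun (e.map_source hye)) h1
  have hev : ∀ᶠ p in 𝓝 (k, y), p.2 ∈ e.source :=
    continuous_snd.continuousAt.eventually (e.open_source.mem_nhds hye)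
  rw [contMDiffAt_iff_target]
  constructor
  · refine (hc.continuousAt.comp hf.continuousAt).congr ?_
    filter_upwards [hev] with p hp using hfe p hp
  · let e' := chartAt (EuclideanSpace ℝ (Fin d)) (k • y)
    refine (S.contMDiffAt_chart_smul hc ho hf (hs (k • y)).choose ?_).congr_of_eventuallyEq ?_
    · rw [hfe _ hye]
      exact _root_.mem_chart_source _ (k • y)
    · filter_upwards [hev] with p hp
      rw [hfe p hp]
      rfl

/-- A continuous local section of the orbit map. -/
theorem exists_local_section (S : LocalSlice E (fun k : G => k • y₀) d)
    (hc : Continuous fun k : G => k • y₀) (ho : IsOpenMap fun k : G => k • y₀) (g : G) :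
    ∃ (V : Set Y) (σ : Y → G), IsOpen V ∧ g • y₀ ∈ V ∧
    ContinuousOn σ V ∧ ∀ y ∈ V, σ y • y₀ = y :=
  ⟨(S.chart hc ho g).source, fun y => g * S.invFun (S.chart hc ho g y),
    (S.chart hc ho g).open_source, S.mem_chart_source hc ho g,
    continuousOn_const.mul (S.contMDiffOn_invFun.continuousOn.comp
      (S.chart hc ho g).continuousOn (S.chart hc ho g).mapsTo),
    fun _ hy => (S.chart hc ho g).left_inv hy⟩

end LocalSlice

/-! ### The homogeneous manifold structure assembled from slices. -/

section HomogeneousStructure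

variable {G : Type*} [Group G] {X : Type*} [MulAction G X]

section Orbit

variable (C : MulAction.orbitRel.Quotient G X)

/-- A point of an orbit. -/
noncomputable def basePoint : C.orbit :=
  ⟨C.out, MulAction.orbitRel.Quotient.mem_orbit.2 (Quotient.out_eq' C)⟩

theorem surjective_smul_basePoint : Function.Surjective fun k : G => k • basePoint C := by
  rintro ⟨x, hx⟩
  rw [MulAction.orbitRel.Quotient.orbit_eq_orbit_out C Quotient.out_eq'] at hx
  obtain ⟨k, hk⟩ := hx
  exact ⟨k, Subtype.ext hk⟩

variable [TopologicalSpace G]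

theorem continuous_smul_basePoint :
    letI := orbitTopology G X
    Continuous fun k : G => k • basePoint C := by
  let _ := orbitTopology G X
  exact continuous_induced_rng.2 (continuous_smul_orbitTopology (G := G) C.out)

theorem isOpenMap_smul_basePoint [IsTopologicalGroup G] :
    letI := orbitTopology G X
    IsOpenMap fun k : G => k • basePoint C := by
  let _ := orbitTopology G X
  intro V hV
  refine isOpen_induced_iff.2 ⟨_, isOpenMap_smul_orbitTopology C.out V hV, ?_⟩
  ext y
  exact exists_congr fun k => and_congr_right fun _ =>
    ⟨fun h => Subtype.ext h, fun h => congrArg Subtype.val h⟩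

/-- A slice for a point of an orbit, seen in that orbit. -/
noncomputable def LocalSlice.toOrbit {E : Type*} [NormedAddCommGroup E] [NormedSpace ℝ E]
    [ChartedSpace E G] {d : ℕ} (S : LocalSlice E (fun k : G => k • C.out) d) :
    LocalSlice E (fun k : G => k • basePoint C) d :=
  S.restr isOpen_univ trivial fun _ _ _ _ =>
    ⟨fun h => Subtype.ext h, fun h => congrArg Subtype.val h⟩

end Orbit

variable {E : Type*} [NormedAddCommGroup E] [NormedSpace ℝ E] [TopologicalSpace G]
  [ChartedSpace E G] [IsTopologicalGroup G] [LieGroup 𝓘(ℝ, E) ∞ G]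
  [SecondCountableTopology G] [ConnectedSpace G]
  [Finite (MulAction.orbitRel.Quotient G X)]

/-- An action with finitely many orbits and closed stabilizers which has slices defines a homogeneous
manifold structure. -/
noncomputable def homogeneousManifoldStructureOfSlices
    (h : ∀ x : X, IsClosed (MulAction.stabilizer G x : Set G)) {d : X → ℕ}
    (S : ∀ x : X, LocalSlice E (fun k : G => k • x) (d x)) :
    HomogeneousManifoldStructure (E := E) G X :=
  letI := orbitTopology G X
  { top := orbitTopology G X
    t2 := t2Space_orbitTopology h
    secondCountable := secondCountable_orbitTopology (G := G)
    component_eq_orbit := connectedComponent_orbitTopology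
    isOpen_orbit := isOpen_orbit_orbitTopology
    dim := fun C => d C.out
    charts := fun C => ((S C.out).toOrbit C).chartedSpace (continuous_smul_basePoint C)
      (isOpenMap_smul_basePoint C) (surjective_smul_basePoint C)
    isManifold := fun C => ((S C.out).toOrbit C).isManifold (continuous_smul_basePoint C)
      (isOpenMap_smul_basePoint C) (surjective_smul_basePoint C)
    smooth_action := fun C => ((S C.out).toOrbit C).contMDiffSMul (continuous_smul_basePoint C)
      (isOpenMap_smul_basePoint C) (surjective_smul_basePoint C) }

end HomogeneousStructure

/-! ### Compactness of Hom(Γ, K). -/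

section Topology

variable {Γ K : Type*} [Group Γ] [Group K] [TopologicalSpace K]

theorem isInducing_coe_monoidHom : IsInducing (fun ρ : Γ →* K => (ρ : Γ → K)) :=
  ⟨rfl⟩

theorem continuous_eval_monoidHom (γ : Γ) : Continuous fun ρ : Γ →* K => ρ γ :=
  (continuous_apply γ).comp isInducing_coe_monoidHom.continuous

instance compactSpace_monoidHom [IsTopologicalGroup K] [T2Space K] [CompactSpace K] :
    CompactSpace (Γ →* K) := by
  refine ⟨isInducing_coe_monoidHom.isCompact_iff.2 ?_⟩
  refine IsClosed.isCompact ?_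
  have : (fun ρ : Γ →* K => (ρ : Γ → K)) '' Set.univ =
      ⋂ (a : Γ) (b : Γ), {f : Γ → K | f (a * b) = f a * f b} := by
    ext f
    simp only [Set.image_univ, Set.mem_range, Set.mem_iInter, Set.mem_ofPred_eq]
    constructor
    · rintro ⟨ρ, rfl⟩ a b
      exact map_mul ρ a b
    · intro h
      exact ⟨MonoidHom.mk' f h, rfl⟩
  rw [this]
  exact isClosed_iInter fun a => isClosed_iInter fun b =>
    isClosed_eq (by fun_prop) (by fun_prop)

end Topology

/-! ### The finite quotient of Γ_(s) seen by K. -/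

section FiniteQuotient

variable (Γ K : Type*) [Group Γ] [Group K] (s : ℕ)

/-- The common kernel of the restrictions to `lcs Γ s` of the homomorphisms from `Γ` to `K`. -/
def commonKernel : Subgroup (lcs Γ s) :=
  ⨅ ρ : Γ →* K, (ρ.comp (lcs Γ s).subtype).ker

instance commonKernel_normal : (commonKernel Γ K s).Normal :=
  Subgroup.normal_iInf_normal fun _ => inferInstance

variable {Γ K s}

/-- The restriction of a homomorphism to `lcs Γ s`, as a homomorphism from the quotient by the
common kernel. -/
def restrictLcs (ρ : Γ →* K) : lcs Γ s ⧸ commonKernel Γ K s →* K :=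
  QuotientGroup.lift _ (ρ.comp (lcs Γ s).subtype) (iInf_le _ ρ)

theorem restrictLcs_mk (ρ : Γ →* K) (γ : lcs Γ s) :
    restrictLcs ρ (γ : lcs Γ s ⧸ commonKernel Γ K s) = ρ γ :=
  rfl

theorem range_restrictLcs (ρ : Γ →* K) :
    (restrictLcs (s := s) ρ).range = (lcs Γ s).map ρ := by
  ext k
  constructor
  · rintro ⟨a, rfl⟩
    obtain ⟨γ, rfl⟩ := QuotientGroup.mk_surjective a
    exact ⟨γ, γ.2, rfl⟩
  · rintro ⟨γ, hγ, rfl⟩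
    exact ⟨((⟨γ, hγ⟩ : lcs Γ s) : lcs Γ s ⧸ commonKernel Γ K s), rfl⟩

/-- It is enough to treat commutators [p, q] with p in Γ_(s-1), whose images are central commutators
in ρ(Γ). Here s ≥ 2 is essential: Γ_(1) is not generated by commutators. -/
theorem pow_eq_one_of_mem_lcs {m : ℕ} (hs : 2 ≤ s) (h : lcs Γ (s + 1) = ⊥)
    (hm : ∀ x y c : K, Commute c x → Commute c y → x * y = c * y * x → c ^ m = 1) (ρ : Γ →* K)
    {γ : Γ} (hγ : γ ∈ lcs Γ s) : ρ γ ^ m = 1 := by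
  have hcen : lcs Γ s ≤ Subgroup.center Γ := lcs_le_center (by omega) h
  let Z : Subgroup Γ :=
    { carrier := {γ | γ ∈ lcs Γ s ∧ ρ γ ^ m = 1}
      one_mem' := ⟨one_mem _, by simp⟩
      mul_mem' := by
        rintro a b ⟨ha, ha'⟩ ⟨hb, hb'⟩
        refine ⟨mul_mem ha hb, ?_⟩
        have hab : Commute a b := (Subgroup.mem_center_iff.1 (hcen ha) b).symm
        rw [map_mul, (hab.map ρ).mul_pow, ha', hb', mul_one]
      inv_mem' := by
        rintro a ⟨ha, ha'⟩
        exact ⟨inv_mem ha, by rw [map_inv, inv_pow, ha', inv_one]⟩ }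
  suffices h : lcs Γ s ≤ Z from (h hγ).2
  obtain ⟨n, rfl⟩ : ∃ n, s = n + 1 := ⟨s - 1, by omega⟩
  conv_lhs => rw [lcs_succ (by omega)]
  refine Subgroup.commutator_le.2 fun p hp q _ => ?_
  have hpq : ⁅p, q⁆ ∈ lcs Γ (n + 1) := by
    rw [lcs_succ (by omega)]
    exact Subgroup.commutator_mem_commutator hp (Subgroup.mem_top q)
  have hc : ∀ g, Commute (ρ ⁅p, q⁆) (ρ g) := fun g =>
    Commute.map (Subgroup.mem_center_iff.1 (hcen hpq) g).symm ρ
  refine ⟨hpq, hm (ρ p) (ρ q) _ (hc p) (hc q) ?_⟩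
  rw [← map_mul, ← map_mul, ← map_mul, commutatorElement_def]
  congr 1
  group

/-- A finitely generated abelian group of bounded exponent is finite. -/
theorem finite_quotient_commonKernel [Group.FG Γ] {m : ℕ} (hs : 2 ≤ s) (h : lcs Γ (s + 1) = ⊥)
    (hm0 : 0 < m)
    (hm : ∀ x y c : K, Commute c x → Commute c y → x * y = c * y * x → c ^ m = 1) :
    Finite (lcs Γ s ⧸ commonKernel Γ K s) := by
  have hcen : lcs Γ s ≤ Subgroup.center Γ := lcs_le_center (by omega) h
  have : Group.FG (lcs Γ s) := (Group.fg_iff_subgroup_fg _).2 (lcs_fg (by omega) h)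
  let _ : CommGroup (lcs Γ s ⧸ commonKernel Γ K s) :=
    { (inferInstance : Group (lcs Γ s ⧸ commonKernel Γ K s)) with
      mul_comm := by
        intro a b
        obtain ⟨a, rfl⟩ := QuotientGroup.mk_surjective a
        obtain ⟨b, rfl⟩ := QuotientGroup.mk_surjective b
        rw [← QuotientGroup.mk_mul, ← QuotientGroup.mk_mul]
        exact congrArg _ (Subtype.ext (Subgroup.mem_center_iff.1 (hcen b.2) a)) }
  refine CommGroup.finite_of_fg_isMulTorsion _ ?_
  intro a
  obtain ⟨γ, rfl⟩ := QuotientGroup.mk_surjective a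
  refine isOfFinOrder_iff_pow_eq_one.2 ⟨m, hm0, ?_⟩
  rw [← QuotientGroup.mk_pow]
  refine (QuotientGroup.eq_one_iff _).2 (Subgroup.mem_iInf.2 fun ρ => ?_)
  rw [MonoidHom.mem_ker]
  simpa using pow_eq_one_of_mem_lcs hs h hm ρ γ.2

end FiniteQuotient

/-! ### Conjugation on the family of subgroups. -/

section Family

variable {Γ K : Type*} [Group Γ] [Group K] {s : ℕ}

/-- The conjugate of a homomorphism. -/
def conjHom (k : K) (ρ : Γ →* K) : Γ →* K :=
  (MulAut.conj k).toMonoidHom.comp ρ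

theorem conjHom_apply (k : K) (ρ : Γ →* K) (γ : Γ) : conjHom k ρ γ = k * ρ γ * k⁻¹ :=
  rfl

theorem proj_conjHom (k : K) (ρ : Γ →* K) : proj Γ K s (conjHom k ρ) = k • proj Γ K s ρ :=
  Subtype.ext (Subgroup.map_map _ _ _).symm

theorem proj_eq_smul {k : K} {ρ ρ' : Γ →* K} (h : ∀ γ ∈ lcs Γ s, ρ' γ = k * ρ γ * k⁻¹) :
    proj Γ K s ρ' = k • proj Γ K s ρ := by
  rw [← proj_conjHom]
  refine Subtype.ext (SetLike.coe_injective ?_)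
  change ρ' '' (lcs Γ s) = conjHom k ρ '' (lcs Γ s)
  exact Set.image_congr h

theorem surjective_proj : Function.Surjective (proj Γ K s) := by
  rintro ⟨_, ρ, rfl⟩
  exact ⟨ρ, rfl⟩

theorem coe_proj (ρ : Γ →* K) : ((proj Γ K s ρ : Subgroup K) : Set K) =
    Set.range (restrictLcs (s := s) ρ) := by
  rw [← MonoidHom.coe_range, range_restrictLcs]
  rfl

theorem smul_eq_self_iff [Finite (lcs Γ s ⧸ commonKernel Γ K s)] (k : K) (ρ : Γ →* K) :
    k • proj Γ K s ρ = proj Γ K s ρ ↔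
      ∀ a, k * restrictLcs (s := s) ρ a * k⁻¹ ∈ Set.range (restrictLcs (s := s) ρ) := by
  have hco : ((k • proj Γ K s ρ : family Γ K s) : Subgroup K) =
      (proj Γ K s ρ : Subgroup K).map (MulAut.conj k).toMonoidHom := rfl
  have hco' : (((k • proj Γ K s ρ : family Γ K s) : Subgroup K) : Set K) =
      (fun x => k * x * k⁻¹) '' Set.range (restrictLcs (s := s) ρ) := by
    rw [hco, Subgroup.coe_map, coe_proj]
    rfl
  rw [Subtype.ext_iff, ← SetLike.coe_set_eq, hco', coe_proj]
  constructor
  · intro h a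
    rw [← h]
    exact ⟨_, ⟨a, rfl⟩, rfl⟩
  · intro h
    have hf : (Set.range (restrictLcs (s := s) ρ)).Finite := Set.finite_range _
    refine Set.eq_of_subset_of_ncard_le ?_ ?_ hf
    -- For a finite subgroup, inclusion of a conjugate forces equality by counting.
    · rintro _ ⟨_, ⟨a, rfl⟩, rfl⟩
      exact h a
    · rw [Set.ncard_image_of_injective]
      intro x y hxy
      simpa using hxy

theorem smul_eq_smul_of_conj_eq {x y : K} {ρ : Γ →* K}
    (h : ∀ a, x * restrictLcs (s := s) ρ a * x⁻¹ = y * restrictLcs (s := s) ρ a * y⁻¹) :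
    x • proj Γ K s ρ = y • proj Γ K s ρ := by
  rw [← proj_conjHom x ρ]
  refine (proj_eq_smul fun γ hγ => ?_)
  exact h ((⟨γ, hγ⟩ : lcs Γ s) : lcs Γ s ⧸ commonKernel Γ K s)

end Family

/-! ### Slices, finiteness of orbits and local triviality. -/

section Slices

variable {E : Type*} [NormedAddCommGroup E] [NormedSpace ℝ E]
  {K : Type*} [Group K] [TopologicalSpace K] [ChartedSpace E K] [LieGroup 𝓘(ℝ, E) ∞ K]
  {Γ : Type*} [Group Γ] {s : ℕ}
  [Finite (lcs Γ s ⧸ commonKernel Γ K s)]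

theorem isClosed_stabilizer_family [IsTopologicalGroup K] [T2Space K] (B : family Γ K s) :
    IsClosed (MulAction.stabilizer (identityComponent E K) B : Set (identityComponent E K)) := by
  obtain ⟨ρ, rfl⟩ := surjective_proj B
  have : (MulAction.stabilizer (identityComponent E K) (proj Γ K s ρ) :
      Set (identityComponent E K)) = ⋂ a, (fun k : identityComponent E K =>
        (k : K) * restrictLcs (s := s) ρ a * (k : K)⁻¹) ⁻¹' Set.range (restrictLcs (s := s) ρ) := by
    ext k
    rw [SetLike.mem_coe, MulAction.mem_stabilizer_iff, Set.mem_iInter]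
    exact smul_eq_self_iff (k : K) ρ
  rw [this]
  exact isClosed_iInter fun a => (Set.finite_range _).isClosed.preimage (by fun_prop)

variable [FiniteDimensional ℝ E]

theorem exists_localSlice_family [IsTopologicalGroup K] [T2Space K] (B : family Γ K s) :
    ∃ d, Nonempty (LocalSlice E (fun k : identityComponent E K => k • B) d) := by
  obtain ⟨ρ, rfl⟩ := surjective_proj B
  set φ := restrictLcs (s := s) ρ
  obtain ⟨d, ⟨S⟩⟩ := exists_localSlice_conj (E := E) φ
  -- Elements of W move no φ(a) onto a different φ(b), so those that normalise the finite image
  -- centralise it. Taking x⁻¹y in W makes setwise and pointwise conjugation have the same fibres.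
  let W : Set K := ⋂ (a) (b), {g | φ b ≠ φ a → g * φ a * g⁻¹ ≠ φ b}
  have hW : IsOpen W := by
    refine isOpen_iInter_of_finite fun a => isOpen_iInter_of_finite fun b => ?_
    by_cases hab : φ b = φ a
    · simp [hab]
    · simp only [ne_eq, hab, not_false_eq_true, forall_const]
      exact isOpen_ne_fun (by fun_prop) continuous_const
  have h1W : (1 : K) ∈ W := by
    simp only [W, Set.mem_iInter]
    intro a b h
    simpa using h.symm
  have hc : Continuous fun p : K × K => p.1⁻¹ * p.2 := by fun_prop
  obtain ⟨V₁, V₂, hV₁, hV₂, h1, h2, hV⟩ := isOpen_prod_iff.1 (hW.preimage hc) 1 1 (by simpa using h1W)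
  let O : Set K := (V₁ ∩ V₂) ∩ identityComponent E K
  have hO : IsOpen O := (hV₁.inter hV₂).inter (isOpen_identityComponent E K)
  have h1O : (1 : K) ∈ O := ⟨⟨h1, h2⟩, (identityComponent E K).one_mem⟩
  have hf : ∀ x ∈ S.source ∩ O, ∀ y ∈ S.source ∩ O,
      ((fun a => x * φ a * x⁻¹) = fun a => y * φ a * y⁻¹) ↔
        x • proj Γ K s ρ = y • proj Γ K s ρ := by
    intro x hx y hy
    constructor
    · exact fun h => smul_eq_smul_of_conj_eq (congrFun h)
    · intro h
      have hxy : x⁻¹ * y ∈ W := hV (Set.mk_mem_prod hx.2.1.1 hy.2.1.2)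
      have h' : (x⁻¹ * y) • proj Γ K s ρ = proj Γ K s ρ := by
        rw [mul_smul, ← h, inv_smul_smul]
      funext a
      obtain ⟨b, hb⟩ := (smul_eq_self_iff _ ρ).1 h' a
      have hba : φ b = φ a := by
        by_contra hne
        exact Set.mem_iInter₂.1 hxy a b hne hb.symm
      have hb' : φ a = x⁻¹ * y * φ a * (x⁻¹ * y)⁻¹ := hba ▸ hb
      exact (congrArg (fun t => x * t * x⁻¹) hb').trans (by group)
  exact ⟨d, ⟨(S.restr hO h1O hf).toIdentityComponent fun x hx =>
    (S.restr_source_subset hO h1O hf hx).2⟩⟩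

/-- Homomorphisms near `ρ₀` agree on `lcs Γ s` with a conjugate of `ρ₀` by an element near `1`. -/
theorem eventually_exists_conj (E : Type*) [NormedAddCommGroup E] [NormedSpace ℝ E]
    [FiniteDimensional ℝ E] {K : Type*} [Group K] [TopologicalSpace K] [ChartedSpace E K]
    [LieGroup 𝓘(ℝ, E) ∞ K] {Γ : Type*} [Group Γ] {s : ℕ}
    [Finite (lcs Γ s ⧸ commonKernel Γ K s)] (ρ₀ : Γ →* K) {O : Set K} (hO : O ∈ 𝓝 (1 : K)) :
    ∀ᶠ ρ in 𝓝 ρ₀, ∃ k ∈ O, ∀ γ ∈ lcs Γ s, ρ γ = k * ρ₀ γ * k⁻¹ := by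
  have : IsTopologicalGroup K := topologicalGroup_of_lieGroup 𝓘(ℝ, E) ∞
  cases nonempty_fintype (lcs Γ s ⧸ commonKernel Γ K s)
  obtain ⟨V, κ, hV, heV, hκ, hκe, hκV⟩ := exists_smooth_conjugator (E := E) (restrictLcs (s := s) ρ₀)
  set ψ := extChartAt 𝓘(ℝ, E) (1 : K)
  have hev : ∀ a, Continuous fun ρ : Γ →* K =>
      restrictLcs (s := s) ρ a * (restrictLcs (s := s) ρ₀ a)⁻¹ := by
    intro a
    obtain ⟨γ, rfl⟩ := QuotientGroup.mk_surjective a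
    exact (continuous_eval_monoidHom (γ : Γ)).mul continuous_const
  have hsrc : ∀ᶠ ρ in 𝓝 ρ₀, ∀ a,
      restrictLcs (s := s) ρ a * (restrictLcs (s := s) ρ₀ a)⁻¹ ∈ ψ.source := by
    refine eventually_all.2 fun a => (hev a).continuousAt.eventually ?_
    beta_reduce
    rw [mul_inv_cancel]
    exact extChartAt_source_mem_nhds (I := 𝓘(ℝ, E)) (1 : K)
  have ht : Tendsto (fun ρ : Γ →* K =>
      tupleChart E (restrictLcs (s := s) ρ₀) (restrictLcs (s := s) ρ)) (𝓝 ρ₀)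
      (𝓝 fun _ => ψ 1) := by
    refine tendsto_pi_nhds.2 fun a => ?_
    have h1 := (hev a).tendsto ρ₀
    rw [mul_inv_cancel] at h1
    exact (continuousAt_extChartAt (I := 𝓘(ℝ, E)) (1 : K)).tendsto.comp h1
  have hκc : ContinuousAt κ (fun _ => ψ 1) := hκ.continuousOn.continuousAt (hV.mem_nhds heV)
  filter_upwards [hsrc, ht.eventually (hV.mem_nhds heV),
    ht.eventually (hκc.eventually (by rwa [hκe]))] with ρ h1 h2 h3
  refine ⟨_, h3, fun γ hγ => ?_⟩
  have h := hκV (restrictLcs ρ) h1 h2 ((⟨γ, hγ⟩ : lcs Γ s) : lcs Γ s ⧸ commonKernel Γ K s)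
  rw [restrictLcs_mk, restrictLcs_mk] at h
  exact eq_mul_inv_of_mul_eq (mul_inv_eq_iff_eq_mul.1 h)

variable (E) in
theorem eventually_proj_mem_orbit (ρ₀ : Γ →* K) : ∀ᶠ ρ in 𝓝 ρ₀,
    proj Γ K s ρ ∈ MulAction.orbit (identityComponent E K) (proj Γ K s ρ₀) := by
  filter_upwards [eventually_exists_conj E (s := s) ρ₀
    ((isOpen_identityComponent E K).mem_nhds (identityComponent E K).one_mem)] with ρ ⟨k, hk, h⟩
  exact ⟨⟨k, hk⟩, (proj_eq_smul h).symm⟩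

variable (E Γ K s) in
-- By rigidity the orbit of p(ρ) is a locally constant function on a compact space.
theorem finite_orbits [IsTopologicalGroup K] [T2Space K] [CompactSpace K] :
    Finite (MulAction.orbitRel.Quotient (identityComponent E K) (family Γ K s)) := by
  let q : (Γ →* K) → MulAction.orbitRel.Quotient (identityComponent E K) (family Γ K s) :=
    fun ρ => Quotient.mk'' (proj Γ K s ρ)
  have hq : IsLocallyConstant q := (IsLocallyConstant.iff_eventually_eq q).2 fun ρ₀ => by
    filter_upwards [eventually_proj_mem_orbit E (s := s) ρ₀] with ρ hρ
    exact Quotient.sound' hρ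
  have hs : Function.Surjective q := (Quotient.mk''_surjective).comp surjective_proj
  have := hq.range_finite
  rw [hs.range_eq] at this
  exact Set.finite_univ_iff.1 this

variable (E Γ K s) in
theorem continuous_proj :
    letI := orbitTopology (identityComponent E K) (family Γ K s)
    Continuous (proj Γ K s) := by
  let _ := orbitTopology (identityComponent E K) (family Γ K s)
  refine continuous_iff_continuousAt.2 fun ρ₀ => ?_
  refine tendsto_nhds.2 fun U hU hρ₀ => ?_
  have h1 : IsOpen (Subtype.val '' ((fun k : identityComponent E K => k • proj Γ K s ρ₀) ⁻¹' U)) :=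
    (isOpen_identityComponent E K).isOpenMap_subtype_val _ (hU _)
  have h2 : (1 : K) ∈ Subtype.val '' ((fun k : identityComponent E K => k • proj Γ K s ρ₀) ⁻¹' U) :=
    ⟨1, by rwa [Set.mem_preimage, one_smul], rfl⟩
  filter_upwards [eventually_exists_conj E (s := s) ρ₀ (h1.mem_nhds h2)] with
    ρ ⟨_, ⟨k, hk, rfl⟩, h⟩
  rw [Set.mem_preimage, proj_eq_smul h]
  exact hk

open Classical in
/-- A local section of an orbit map trivializes the projection. -/
noncomputable def trivializationOfSection [IsTopologicalGroup K] [TopologicalSpace (family Γ K s)]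
    (hp : Continuous (proj Γ K s)) {B : family Γ K s} {V : Set (family Γ K s)} (hV : IsOpen V)
    (σ : family Γ K s → K) (hσ : ContinuousOn σ V) (hσB : ∀ y ∈ V, σ y • B = y) :
    Bundle.Trivialization (proj Γ K s ⁻¹' {B}) (proj Γ K s) where
  -- Conjugating by σ⁻¹ carries ρ into the fibre over B. Outside V an arbitrary point of that fibre
  -- is used.
  toFun ρ := (proj Γ K s ρ, if h : proj Γ K s ρ ∈ V then
    ⟨conjHom (σ (proj Γ K s ρ))⁻¹ ρ, by
      rw [Set.mem_preimage, proj_conjHom]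
      exact inv_smul_eq_iff.2 (hσB _ h).symm⟩
    else ⟨(surjective_proj B).choose, (surjective_proj B).choose_spec⟩)
  invFun z := conjHom (σ z.1) z.2
  source := proj Γ K s ⁻¹' V
  target := V ×ˢ Set.univ
  baseSet := V
  open_baseSet := hV
  source_eq := rfl
  target_eq := rfl
  proj_toFun _ _ := rfl
  map_source' ρ hρ := ⟨hρ, trivial⟩
  map_target' z hz := by
    rw [Set.mem_preimage, proj_conjHom, show proj Γ K s z.2 = B from z.2.2, hσB _ hz.1]
    exact hz.1
  left_inv' ρ hρ := by
    have hρ' : proj Γ K s ρ ∈ V := hρ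
    ext γ
    simp only [dif_pos hρ', conjHom_apply]
    group
  right_inv' z hz := by
    have h : proj Γ K s (conjHom (σ z.1) z.2) = z.1 := by
      rw [proj_conjHom, show proj Γ K s z.2 = B from z.2.2, hσB _ hz.1]
    refine Prod.ext h (Subtype.ext ?_)
    ext γ
    have hz1 : z.1 ∈ V := hz.1
    simp only [h, dif_pos hz1, conjHom_apply]
    group
  open_source := hV.preimage hp
  open_target := hV.prod isOpen_univ
  continuousOn_toFun := by
    refine hp.continuousOn.prodMk (IsInducing.subtypeVal.continuousOn_iff.2 ?_)
    refine isInducing_coe_monoidHom.continuousOn_iff.2 (continuousOn_pi.2 fun γ => ?_)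
    have hσp : ContinuousOn (fun ρ => σ (proj Γ K s ρ)) (proj Γ K s ⁻¹' V) :=
      hσ.comp hp.continuousOn fun _ h => h
    refine ((hσp.inv.mul (continuous_eval_monoidHom γ).continuousOn).mul hσp).congr ?_
    intro ρ hρ
    have hρ' : proj Γ K s ρ ∈ V := hρ
    simp [dif_pos hρ', conjHom_apply]
  continuousOn_invFun := by
    refine isInducing_coe_monoidHom.continuousOn_iff.2 (continuousOn_pi.2 fun γ => ?_)
    have hσp : ContinuousOn (fun z : family Γ K s × (proj Γ K s ⁻¹' {B}) => σ z.1)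
        (V ×ˢ Set.univ) := hσ.comp continuous_fst.continuousOn fun _ h => h.1
    exact (hσp.mul ((continuous_eval_monoidHom γ).comp
      (continuous_subtype_val.comp continuous_snd)).continuousOn).mul hσp.inv

theorem isLocallyTrivialFibreBundle_proj [IsTopologicalGroup K] [T2Space K] :
    letI := orbitTopology (identityComponent E K) (family Γ K s)
    IsLocallyTrivialFibreBundle (proj Γ K s) := by
  let _ := orbitTopology (identityComponent E K) (family Γ K s)
  intro B
  obtain ⟨d, ⟨S⟩⟩ := exists_localSlice_family (E := E) B
  obtain ⟨V, σ, hV, hB, hσ, hσB⟩ := S.exists_local_section (continuous_smul_orbitTopology B)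
    (isOpenMap_smul_orbitTopology B) 1
  rw [one_smul] at hB
  exact ⟨trivializationOfSection (continuous_proj E K Γ s) hV (fun y => (σ y : K))
    (continuous_subtype_val.comp_continuousOn hσ) hσB, hB⟩

end Slices

/-! ### Commutativity of the members, and the theorem. -/

theorem isMulCommutative_of_mem_family {Γ K : Type*} [Group Γ] [Group K] {s : ℕ} (hs : 1 ≤ s)
    (h : lcs Γ (s + 1) = ⊥) {A : Subgroup K} (hA : A ∈ family Γ K s) : IsMulCommutative A := by
  obtain ⟨ρ, rfl⟩ := hA
  refine ⟨⟨?_⟩⟩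
  rintro ⟨_, a, ha, rfl⟩ ⟨_, b, -, rfl⟩
  have hab : b * a = a * b := Subgroup.mem_center_iff.1 (lcs_le_center hs h ha) b
  refine Subtype.ext ?_
  change ρ a * ρ b = ρ b * ρ a
  rw [← map_mul, ← map_mul, hab]

end NilpotentRep

theorem proposition2p1
    {E : Type*} [NormedAddCommGroup E] [NormedSpace ℝ E] [FiniteDimensional ℝ E]
    {K : Type*} [Group K] [TopologicalSpace K] [ChartedSpace E K] [LieGroup 𝓘(ℝ, E) ∞ K]
    [CompactSpace K]
    {Γ : Type*} [Group Γ] [Group.FG Γ]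
    (s : ℕ) (hs : 2 ≤ s) (hΓ : NilpotentRep.IsStepNilpotent Γ s) :
    (∀ A ∈ NilpotentRep.family Γ K s, IsMulCommutative A) ∧
    ∃ S : NilpotentRep.HomogeneousManifoldStructure (E := E)
        (NilpotentRep.identityComponent E K) (NilpotentRep.family Γ K s),
      letI : TopologicalSpace (NilpotentRep.family Γ K s) := S.top
      Finite (ConnectedComponents (NilpotentRep.family Γ K s)) ∧
      NilpotentRep.IsLocallyTrivialFibreBundle (NilpotentRep.proj Γ K s) := by
  open NilpotentRep in
  refine ⟨fun A hA => isMulCommutative_of_mem_family (by omega) hΓ.2 hA, ?_⟩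
  have : IsTopologicalGroup K := topologicalGroup_of_lieGroup 𝓘(ℝ, E) ∞
  have : T1Space K := ChartedSpace.t1Space E K
  have : SecondCountableTopology K := ChartedSpace.secondCountable_of_sigmaCompact E K
  have : SecondCountableTopology (identityComponent E K) :=
    TopologicalSpace.Subtype.secondCountableTopology (identityComponent E K : Set K)
  have : ConnectedSpace (identityComponent E K) :=
    isConnected_iff_connectedSpace.1 isConnected_connectedComponent
  obtain ⟨V, hV, hVn⟩ := exists_nhds_no_small_subgroups E K
  obtain ⟨m, hm0, hm⟩ := exists_uniform_exponent hV hVn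
  have : Finite (lcs Γ s ⧸ commonKernel Γ K s) := finite_quotient_commonKernel hs hΓ.2 hm0 hm
  have hfin := finite_orbits E K Γ s
  choose d S using fun B : family Γ K s => exists_localSlice_family (E := E) B
  refine ⟨homogeneousManifoldStructureOfSlices isClosed_stabilizer_family fun B => (S B).some, ?_,
    isLocallyTrivialFibreBundle_proj⟩
  let _ := orbitTopology (identityComponent E K) (family Γ K s)
  -- Components are orbits, so orbit representatives meet every component.
  refine Finite.of_surjective (fun C : MulAction.orbitRel.Quotient (identityComponent E K)
    (family Γ K s) => (C.out : ConnectedComponents (family Γ K s))) fun c => ?_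
  obtain ⟨B, rfl⟩ := ConnectedComponents.surjective_coe c
  refine ⟨Quotient.mk'' B, ConnectedComponents.coe_eq_coe'.2 ?_⟩
  rw [connectedComponent_orbitTopology B]
  exact MulAction.orbitRel_apply.1 (Quotient.mk_out (s := MulAction.orbitRel _ _) B)
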